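/- Let $\varkappa>0$, $\Lambda\ge 0$, $c\ge 0$, and let $\mu(x,\cdot)$, $x\in\mathbb Z\setminus\{0\}$, be independent identically distributed random variables on a probability space $(\Omega,\mathcal F,\mathbb P)$ with values in $[0,c]$ and distribution function $F_\mu$. For fixed $\omega$ consider the continuous-time branching random walk on $\mathbb Z$ in the environment $\mu(\cdot,\omega)$, started from one particle at a point $x$: a particle located at $0$ waits an exponential time with parameter $\varkappa+\Lambda$ and then, with probability $\Lambda/(\varkappa+\Lambda)$, splits into two particles at $0$, or, with probability $\varkappa/(\varkappa+\Lambda)$, moves to one of the two neighbouring points, chosen with equal probabilities; a particle located at $z\neq 0$ waits an exponential time with parameter $\varkappa+\mu(z,\omega)$ and then, with probability $\mu(z,\omega)/(\varkappa+\mu(z,\omega))$, disappears, or, with probability $\varkappa/(\varkappa+\mu(z,\omega))$, moves to one of the two neighbouring points, chosen with equal probabilities; all particles evolve independently of each other and of the past. Let $m_1(t,x,y,\omega)$ be the mean number of particles at $y$ at time $t$ (for fixed $\omega$), and let $$P(\Lambda,\varkappa,F_\mu)=\mathbb P\Bigl\{\omega:\ \exists\,\lambda>0,\ \exists\, C(x,y)>0:\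 \lim_{t\to\infty}\frac{m_1(t,x,y,\omega)}{C(x,y)e^{\lambda t}}=1\ \ \forall x,y\in\mathbb Z\Bigr\}.$$ For a positive integer $l$ consider the equation in the unknown $\lambda$ $$\frac{2\alpha\varkappa}{1+\sqrt{1-4\alpha^2}}+\varkappa\,\alpha^{2l}R(\alpha,\beta)+\Lambda-\varkappa-\lambda=0,$$ where $$\alpha=\frac{\varkappa/2}{\varkappa+\lambda},\qquad \beta=\frac{\varkappa/2}{c+\varkappa+\lambda},\qquad R(\alpha,\beta)=\sum_{k=0}^\infty\bigl(\beta^{2k+1}-\alpha^{2k+1}\bigr)C_{k+l}$$ and $C_n$ is the $n$-th Catalan number. If this equation has a solution $\lambda>0$ for some positive integer $l$, and $\hat l$ is the smallest such $l$, then $$P(\Lambda,\varkappa,F_\mu)\ \ge\ \bigl(\mathbb P\{\mu(x,\omega)=0\}\bigr)^{2\hat l}.$$ If there is no positive integer $l$ for which the equation has a solution $\lambda>0$, then $P(\Lambda,\varkappa,F_\mu)=0$. -/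

import Mathlib

open MeasureTheory ProbabilityTheory Filter Topology
open scoped ENNReal unitInterval

noncomputable section

namespace BRW

/-- The lattice points other than the reproduction source `0`; these carry a killing intensity. -/
abbrev KillSite : Type := {z : ℤ // z ≠ 0}

/-- The total rate of events of a particle located at `z`, in the killing environment `μ`:
`κ + Λ` at the source and `κ + μ z` elsewhere (the inverse of the mean waiting time). -/
def totalRate (κ Λ : ℝ) (μ : KillSite → ℝ) (z : ℤ) : ℝ :=
  if h : z = 0 then κ + Λ else κ + μ ⟨z, h⟩

/-- What ends the waiting period of a particle: a step to a neighbouring point, or a reaction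
(splitting in two at the source, death elsewhere). -/
inductive Event : Type
  | left : Event
  | right : Event
  | react : Event

/-- The event of a particle at `z` selected by a uniform variable `u`: a step to the left and a
step to the right have probability `(κ / 2) / totalRate` each, a reaction has the remaining
probability (`Λ / totalRate` at the source, `μ z / totalRate` elsewhere). -/
def eventAt (κ Λ : ℝ) (μ : KillSite → ℝ) (z : ℤ) (u : I) : Event :=
  if (u : ℝ) < (κ / 2) / totalRate κ Λ μ z then Event.left
  else if (u : ℝ) < κ / totalRate κ Λ μ z then Event.right
  else Event.react

/-- Labels of (potential) particles: `[]` is the initial particle and `b :: v` is a successor of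
`v`. A step turns `v` into its single successor `false :: v`; a splitting of `v` produces the two
offspring `false :: v` and `true :: v`. -/
abbrev Label : Type := List Bool

/-- The randomness driving the evolution in a fixed environment: for every label, a variable that
gives the waiting time and a variable that selects the event. -/
abbrev Marks : Type := Label → ℝ × I

/-- The law of the pair of driving variables of one label: a standard exponential variable and an
independent uniform variable on `[0, 1]`. -/
def markLaw : Measure (ℝ × I) := (expMeasure 1).prod volume

/-- The law of the driving randomness: the variables of different labels are independent. -/
def marksLaw : Measure Marks := Measure.infinitePi fun _ : Label => markLaw

/-- The waiting time of the particle `v` when it is located at `z`; it is exponential with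
parameter `totalRate κ Λ μ z`. -/
def waiting (κ Λ : ℝ) (μ : KillSite → ℝ) (ξ : Marks) (v : Label) (z : ℤ) : ℝ :=
  (ξ v).1 / totalRate κ Λ μ z

/-- Place and time at which the particle `v` starts, or `none` if there is no such particle, when
the process starts at time `0` with a single particle at `x`. -/
def start (κ Λ : ℝ) (μ : KillSite → ℝ) (x : ℤ) (ξ : Marks) : Label → Option (ℤ × ℝ)
  | [] => some (x, 0)
  | b :: v =>
    match start κ Λ μ x ξ v with
    | none => none
    | some (z, s) =>
      match eventAt κ Λ μ z (ξ v).2 with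
      | Event.left => if b = false then some (z - 1, s + waiting κ Λ μ ξ v z) else none
      | Event.right => if b = false then some (z + 1, s + waiting κ Λ μ ξ v z) else none
      | Event.react => if z = 0 then some (0, s + waiting κ Λ μ ξ v z) else none

/-- At time `t` the particle `v` exists and is located at `y`. -/
def PresentAt (κ Λ : ℝ) (μ : KillSite → ℝ) (x : ℤ) (ξ : Marks) (v : Label) (t : ℝ) (y : ℤ) :
    Prop :=
  ∃ s : ℝ, start κ Λ μ x ξ v = some (y, s) ∧ s ≤ t ∧ t < s + waiting κ Λ μ ξ v y

open Classical in
/-- The number `N_t(y)` of particles at `y` at time `t`. -/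
def particleNumber (κ Λ : ℝ) (μ : KillSite → ℝ) (x : ℤ) (ξ : Marks) (t : ℝ) (y : ℤ) : ℝ≥0∞ :=
  ∑' v : Label, if PresentAt κ Λ μ x ξ v t y then 1 else 0

/-- The mean particle number `m₁(t, x, y) = E_x N_t(y)` in the fixed environment `μ`. -/
def meanNumber (κ Λ : ℝ) (μ : KillSite → ℝ) (t : ℝ) (x y : ℤ) : ℝ≥0∞ :=
  ∫⁻ ξ : Marks, particleNumber κ Λ μ x ξ t y ∂marksLaw

/-- Exponential growth of the mean particle numbers at all lattice points in the environment `μ`: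
for some `r > 0` and some `C x y > 0`, `m₁(t, x, y) / (C x y * exp (r t)) → 1` for all `x, y`. -/
def Supercritical (κ Λ : ℝ) (μ : KillSite → ℝ) : Prop :=
  ∃ r : ℝ, 0 < r ∧ ∃ C : ℤ → ℤ → ℝ, ∀ x y : ℤ, 0 < C x y ∧
    Tendsto (fun t : ℝ => meanNumber κ Λ μ t x y / ENNReal.ofReal (C x y * Real.exp (r * t)))
      atTop (𝓝 1)

/-- The probability that the random killing environment `μ` is supercritical. -/
def growthProb {Ω : Type*} [MeasurableSpace Ω] (P : Measure Ω) (κ Λ : ℝ)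
    (μ : KillSite → Ω → ℝ) : ℝ≥0∞ :=
  P {ω | Supercritical κ Λ fun z => μ z ω}

/-- `r` is a positive solution of the island equation with island size `l`, the series
`R(α, β) = ∑ₖ (β^(2k+1) - α^(2k+1)) C_{k+l}` with Catalan numbers `C_n` being convergent. -/
def IsPositiveSolution (κ Λ c : ℝ) (l : ℕ) (r : ℝ) : Prop :=
  0 < r ∧ ∃ α β R : ℝ, α = (κ / 2) / (κ + r) ∧ β = (κ / 2) / (c + κ + r) ∧
    HasSum (fun k : ℕ => (β ^ (2 * k + 1) - α ^ (2 * k + 1)) * (catalan (k + l) : ℝ)) R ∧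
    2 * α * κ / (1 + Real.sqrt (1 - 4 * α ^ 2)) + κ * α ^ (2 * l) * R + Λ - κ - r = 0

/-- The positive island sizes for which the island equation has a positive solution. -/
def admissibleSizes (κ Λ c : ℝ) : Set ℕ :=
  {l : ℕ | 0 < l ∧ ∃ r : ℝ, IsPositiveSolution κ Λ c l r}

end BRW

end

/-! The mean numbers form a semigroup: m₁(t, x, y) = (exp(tH) δ_x)(y) on ℓ²(ℤ), where H = H₀ + Λ δ₀
and H₀ is the lattice Laplacian with coefficient κ/2 minus the killing (`meanNumber_eq_heatKernel`).
It is proved by matching the sum over generations of particles with the iterated Duhamel formula.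

H₀ is self-adjoint and nonpositive, and H is a rank one perturbation of it. Let G_r = (r - H₀)⁻¹ δ₀.
If Λ G_r(0) = 1 with r > 0, then r is the top of the spectrum of H, simple, with positive
eigenfunction G_r, and exp(-rt) exp(tH) converges strongly to the projection on it
(`tendsto_exp_smul_schrodinger`). As G_r(0) is continuous in r and at most 1/r, the inequality Λ
G_r(0) ≥ 1 at one r > 0 suffices (`exists_green_eq`).

The island equation supplies this inequality. Its series collapses to κ F_l + Λ - κ - r = 0
(`isPositiveSolution_iff`), where F_l sums the weights of first passages one step towards the source
from depth l of the island, charging the maximal killing c to as many steps as can lie outside.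
Splitting a passage at its first step gives F_{l+1} ≤ α + α F_l F_{l+1}. Products of F_l, F_{l-1},
... along the radius therefore form a function φ with φ(0) = 1 and (r - H₀) φ ≤ Λ δ₀, and the
minimum principle yields 1 ≤ Λ G_r(0) (`one_le_mul_green`). An island of size l has 2l killing
sites, and independence gives the probability that all of them are free of killing.

The second claim concerns only Λ = 0: for Λ > 0 every large enough l is admissible
(`admissibleSizes_nonempty`), and for Λ = 0 the mean numbers are at most 1. -/

noncomputable section

/-! ### Catalan series of first passages. -/

namespace BRW

/-- The value at `α` of the generating function of first passages to a neighbouring point. -/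
def firstPassage (α : ℝ) : ℝ := 2 * α / (1 + Real.sqrt (1 - 4 * α ^ 2))

lemma firstPassage_nonneg {α : ℝ} (h0 : 0 ≤ α) : 0 ≤ firstPassage α := by
  unfold firstPassage; positivity

lemma sqrt_discr_sq {α : ℝ} (h0 : 0 ≤ α) (h1 : α < 1 / 2) :
    Real.sqrt (1 - 4 * α ^ 2) ^ 2 = 1 - 4 * α ^ 2 :=
  Real.sq_sqrt (by nlinarith)

lemma sqrt_discr_pos {α : ℝ} (h0 : 0 ≤ α) (h1 : α < 1 / 2) :
    0 < Real.sqrt (1 - 4 * α ^ 2) :=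
  Real.sqrt_pos.2 (by nlinarith)

lemma firstPassage_quadratic {α : ℝ} (h0 : 0 ≤ α) (h1 : α < 1 / 2) :
    firstPassage α = α + α * firstPassage α ^ 2 := by
  have hs := sqrt_discr_sq h0 h1
  have hp := sqrt_discr_pos h0 h1
  unfold firstPassage
  set s := Real.sqrt (1 - 4 * α ^ 2)
  field_simp
  linear_combination -α * hs

lemma one_sub_two_mul_firstPassage {α : ℝ} (h0 : 0 ≤ α) (h1 : α < 1 / 2) :
    1 - 2 * α * firstPassage α = Real.sqrt (1 - 4 * α ^ 2) := by
  have hs := sqrt_discr_sq h0 h1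
  have hp := sqrt_discr_pos h0 h1
  unfold firstPassage
  set s := Real.sqrt (1 - 4 * α ^ 2)
  field_simp
  linear_combination (-1 : ℝ) * hs

lemma firstPassage_lt_one {α : ℝ} (h0 : 0 ≤ α) (h1 : α < 1 / 2) : firstPassage α < 1 := by
  have hp := sqrt_discr_pos h0 h1
  unfold firstPassage
  rw [div_lt_one (by positivity)]
  linarith

/-- Any other root `F` satisfies α (F + `firstPassage α`) = 1, hence 2α `firstPassage α` ≥ 1,
against `one_sub_two_mul_firstPassage`. This selects the smaller root. -/
lemma eq_firstPassage {α F : ℝ} (h0 : 0 ≤ α) (h1 : α < 1 / 2) (hF : F ≤ firstPassage α)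
    (hq : F = α + α * F ^ 2) : F = firstPassage α := by
  have h2 := firstPassage_quadratic h0 h1
  have h3 := one_sub_two_mul_firstPassage h0 h1
  have hp := sqrt_discr_pos h0 h1
  have h4 : (F - firstPassage α) * (1 - α * (F + firstPassage α)) = 0 := by
    linear_combination hq - h2
  rcases mul_eq_zero.1 h4 with h | h
  · linarith
  · nlinarith [mul_le_mul_of_nonneg_left hF h0]

/-- The weight of the first passages of length `2 * n + 1`. -/
def passageTerm (α : ℝ) (n : ℕ) : ℝ := (catalan n : ℝ) * α ^ (2 * n + 1)

lemma passageTerm_nonneg {α : ℝ} (h0 : 0 ≤ α) (n : ℕ) : 0 ≤ passageTerm α n := by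
  unfold passageTerm; positivity

lemma passageTerm_succ (α : ℝ) (n : ℕ) :
    passageTerm α (n + 1) =
      α * ∑ p ∈ Finset.HasAntidiagonal.antidiagonal n, passageTerm α p.1 * passageTerm α p.2 := by
  unfold passageTerm
  rw [catalan_succ', Finset.mul_sum]
  push_cast
  rw [Finset.sum_mul]
  refine Finset.sum_congr rfl fun p hp => ?_
  rw [← Finset.HasAntidiagonal.mem_antidiagonal.1 hp]
  ring

/-- The triangle i + j < N lies inside the square i, j < N. -/
lemma sum_antidiagonal_le_sq {f : ℕ → ℝ} (hf : ∀ n, 0 ≤ f n) (N : ℕ) :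
    ∑ n ∈ Finset.range N, ∑ p ∈ Finset.HasAntidiagonal.antidiagonal n, f p.1 * f p.2 ≤
      (∑ n ∈ Finset.range N, f n) ^ 2 := by
  rw [sq, Finset.sum_mul_sum, ← Finset.sum_product']
  refine le_trans (le_of_eq ?_) (Finset.sum_fiberwise_le_sum_of_sum_fiber_nonneg
    (t := Finset.range N) (g := fun p : ℕ × ℕ => p.1 + p.2) fun y _ =>
      Finset.sum_nonneg fun p _ => mul_nonneg (hf _) (hf _))
  refine Finset.sum_congr rfl fun n hn => Finset.sum_congr ?_ fun _ _ => rfl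
  ext p
  simp only [Finset.HasAntidiagonal.mem_antidiagonal, Finset.mem_filter, Finset.mem_product,
    Finset.mem_range] at *
  omega

/-- By the Catalan recursion the partial sums satisfy S_{N+1} ≤ α + α S_N², and `firstPassage α` is
a fixed point of this monotone map. -/
lemma sum_passageTerm_le {α : ℝ} (h0 : 0 ≤ α) (h1 : α < 1 / 2) (N : ℕ) :
    ∑ n ∈ Finset.range N, passageTerm α n ≤ firstPassage α := by
  induction N with
  | zero => simpa using firstPassage_nonneg h0
  | succ N ih =>
    rw [Finset.sum_range_succ', firstPassage_quadratic h0 h1]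
    simp only [passageTerm_succ]
    rw [← Finset.mul_sum]
    have h2 := sum_antidiagonal_le_sq (passageTerm_nonneg h0) N
    have h3 : (∑ n ∈ Finset.range N, passageTerm α n) ^ 2 ≤ firstPassage α ^ 2 :=
      pow_le_pow_left₀ (Finset.sum_nonneg fun n _ => passageTerm_nonneg h0 n) ih 2
    have h4 := mul_le_mul_of_nonneg_left (h2.trans h3) h0
    have h5 : passageTerm α 0 = α := by simp [passageTerm]
    linarith

lemma summable_passageTerm {α : ℝ} (h0 : 0 ≤ α) (h1 : α < 1 / 2) : Summable (passageTerm α) :=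
  summable_of_sum_range_le (passageTerm_nonneg h0) (sum_passageTerm_le h0 h1)

lemma hasSum_passageTerm {α : ℝ} (h0 : 0 ≤ α) (h1 : α < 1 / 2) :
    HasSum (passageTerm α) (firstPassage α) := by
  have hs := summable_passageTerm h0 h1
  have hn := hs.norm
  have hq : ∑' n, passageTerm α n = α + α * (∑' n, passageTerm α n) ^ 2 := by
    conv_lhs => rw [hs.tsum_eq_zero_add]
    simp only [passageTerm_succ]
    rw [tsum_mul_left, sq, tsum_mul_tsum_eq_tsum_sum_antidiagonal_of_summable_norm hn hn]
    simp [passageTerm]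
  rw [← eq_firstPassage h0 h1 (Real.tsum_le_of_sum_range_le (passageTerm_nonneg h0)
    (sum_passageTerm_le h0 h1)) hq]
  exact hs.hasSum

/-- The number of steps from outside the island of size `l` attributed to a passage of length
`2 * n + 1`. -/
def outerSteps (l n : ℕ) : ℕ := if n < l then 0 else 2 * (n - l) + 1

/-- A passage of 2(i + j + 1) + 1 steps that starts outwards splits into that step, a passage of 2i
+ 1 steps begun one site deeper, and one of 2j + 1 steps begun at the original site. The maximal
numbers of outer steps are superadditive under this splitting. -/
lemma outerSteps_add_le (l i j : ℕ) :
    outerSteps l i + outerSteps (l + 1) j ≤ outerSteps (l + 1) (i + j + 1) := by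
  unfold outerSteps
  split_ifs <;> omega

/-- The lower bound for the first passage through an island of size `l`, with step weight `α`
inside and `q * α` outside. -/
def islandPassage (α q : ℝ) (l : ℕ) : ℝ := ∑' n, passageTerm α n * q ^ outerSteps l n

section

variable {α q : ℝ} (h0 : 0 ≤ α) (h1 : α < 1 / 2) (hq0 : 0 ≤ q) (hq1 : q ≤ 1)

include h0 hq0 in
lemma islandTerm_nonneg (l n : ℕ) : 0 ≤ passageTerm α n * q ^ outerSteps l n :=
  mul_nonneg (passageTerm_nonneg h0 n) (pow_nonneg hq0 _)

include h0 hq0 hq1 in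
lemma islandTerm_le (l n : ℕ) : passageTerm α n * q ^ outerSteps l n ≤ passageTerm α n :=
  mul_le_of_le_one_right (passageTerm_nonneg h0 n) (pow_le_one₀ hq0 hq1)

include h0 h1 hq0 hq1 in
lemma summable_islandTerm (l : ℕ) : Summable fun n => passageTerm α n * q ^ outerSteps l n :=
  (summable_passageTerm h0 h1).of_nonneg_of_le (islandTerm_nonneg h0 hq0 l)
    (islandTerm_le h0 hq0 hq1 l)

include h0 hq0 in
lemma islandPassage_nonneg (l : ℕ) : 0 ≤ islandPassage α q l :=
  tsum_nonneg (islandTerm_nonneg h0 hq0 l)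

include h0 h1 hq0 hq1 in
lemma islandPassage_le (l : ℕ) : islandPassage α q l ≤ firstPassage α := by
  rw [← (hasSum_passageTerm h0 h1).tsum_eq]
  exact (summable_islandTerm h0 h1 hq0 hq1 l).tsum_le_tsum (islandTerm_le h0 hq0 hq1 l)
    (summable_passageTerm h0 h1)

include h0 h1 hq0 hq1 in
lemma islandPassage_zero : islandPassage α q 0 = firstPassage (q * α) := by
  have h2 : q * α ≤ α := mul_le_of_le_one_left h0 hq1
  rw [← (hasSum_passageTerm (mul_nonneg hq0 h0) (h2.trans_lt h1)).tsum_eq]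
  refine tsum_congr fun n => ?_
  simp only [passageTerm, outerSteps, Nat.not_lt_zero, if_false, Nat.sub_zero, mul_pow]
  ring

include h0 h1 hq0 hq1 in
-- First step decomposition: a direct passage, or a step outwards followed by two passages at depths
-- l and l + 1. Only an inequality results, because `outerSteps_add_le` can be strict and `q ≤ 1`.
lemma islandPassage_succ_le (l : ℕ) : islandPassage α q (l + 1) ≤
    α + α * (islandPassage α q l * islandPassage α q (l + 1)) := by
  have hs := summable_islandTerm h0 h1 hq0 hq1
  conv_lhs => rw [islandPassage, (hs (l + 1)).tsum_eq_zero_add]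
  unfold islandPassage
  rw [tsum_mul_tsum_eq_tsum_sum_antidiagonal_of_summable_norm (hs l).norm (hs (l + 1)).norm,
    ← tsum_mul_left]
  refine add_le_add (by simp [passageTerm, outerSteps]) (((summable_nat_add_iff 1).2
    (hs (l + 1))).tsum_le_tsum (fun n => ?_) (((summable_norm_sum_mul_antidiagonal_of_summable_norm
      (hs l).norm (hs (l + 1)).norm).of_norm).mul_left α))
  rw [passageTerm_succ, mul_assoc, Finset.sum_mul]
  refine mul_le_mul_of_nonneg_left (Finset.sum_le_sum fun p hp => ?_) h0
  rw [← Finset.HasAntidiagonal.mem_antidiagonal.1 hp]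
  have h2 := pow_le_pow_of_le_one hq0 hq1 (outerSteps_add_le l p.1 p.2)
  rw [pow_add] at h2
  have h3 := mul_le_mul_of_nonneg_left h2
    (mul_nonneg (passageTerm_nonneg h0 p.1) (passageTerm_nonneg h0 p.2))
  linarith

include h0 h1 hq0 hq1 in
lemma sum_range_le_islandPassage (l : ℕ) :
    ∑ n ∈ Finset.range l, passageTerm α n ≤ islandPassage α q l := by
  refine le_trans (le_of_eq (Finset.sum_congr rfl fun n hn => ?_))
    ((summable_islandTerm h0 h1 hq0 hq1 l).sum_le_tsum (Finset.range l)
      fun n _ => islandTerm_nonneg h0 hq0 l n)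
  simp [outerSteps, Finset.mem_range.1 hn]

include h0 h1 hq0 hq1 in
-- The two series agree in their first l terms; shifting the index by l exposes the series R of the
-- island equation with the factor α^(2l).
lemma hasSum_island_remainder (l : ℕ) :
    HasSum (fun k : ℕ => α ^ (2 * l) *
      (((q * α) ^ (2 * k + 1) - α ^ (2 * k + 1)) * (catalan (k + l) : ℝ)))
      (islandPassage α q l - firstPassage α) := by
  have h2 : HasSum _ (islandPassage α q l - firstPassage α) :=
    (summable_islandTerm h0 h1 hq0 hq1 l).hasSum.sub (hasSum_passageTerm h0 h1)
  rw [← hasSum_nat_add_iff' l, Finset.sum_eq_zero, sub_zero] at h2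
  · refine h2.congr_fun fun k => ?_
    simp only [passageTerm, outerSteps, mul_pow, Nat.not_lt.2 (Nat.le_add_left l k), if_false,
      Nat.add_sub_cancel]
    ring
  · intro n hn
    simp [outerSteps, Finset.mem_range.1 hn]

end

/-! ### The island equation and its solvability. -/

/-- The weight `α` of a step inside the island. -/
def innerWeight (κ r : ℝ) : ℝ := (κ / 2) / (κ + r)

/-- The ratio `β / α` of the weights of a step outside and inside the island. -/
def weightRatio (κ c r : ℝ) : ℝ := (κ + r) / (c + κ + r)

section

variable {κ c r : ℝ} (hκ : 0 < κ) (hc : 0 ≤ c) (hr : 0 < r)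

include hκ hr in
lemma innerWeight_pos : 0 < innerWeight κ r := by unfold innerWeight; positivity

include hκ hr in
lemma innerWeight_lt : innerWeight κ r < 1 / 2 := by
  unfold innerWeight
  rw [div_lt_iff₀ (by positivity)]
  linarith

include hκ hc hr in
lemma weightRatio_nonneg : 0 ≤ weightRatio κ c r := by unfold weightRatio; positivity

include hκ hc hr in
lemma weightRatio_le_one : weightRatio κ c r ≤ 1 := by
  unfold weightRatio
  rw [div_le_one (by positivity)]
  linarith

include hκ hc hr in
lemma weightRatio_mul_innerWeight :
    weightRatio κ c r * innerWeight κ r = (κ / 2) / (c + κ + r) := by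
  unfold weightRatio innerWeight
  field_simp

include hκ hc hr in
lemma isPositiveSolution_iff {Λ : ℝ} {l : ℕ} : IsPositiveSolution κ Λ c l r ↔
    κ * islandPassage (innerWeight κ r) (weightRatio κ c r) l + Λ - κ - r = 0 := by
  have hα := innerWeight_pos hκ hr
  have hsum := hasSum_island_remainder hα.le (innerWeight_lt hκ hr)
    (weightRatio_nonneg hκ hc hr) (weightRatio_le_one hκ hc hr) l
  rw [weightRatio_mul_innerWeight hκ hc hr] at hsum
  have hF : ∀ α : ℝ, 2 * α * κ / (1 + Real.sqrt (1 - 4 * α ^ 2)) = κ * firstPassage α := by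
    intro α
    unfold firstPassage
    ring
  constructor
  · rintro ⟨_, α, β, R, rfl, rfl, hR, heq⟩
    have h2 := (hR.mul_left (innerWeight κ r ^ (2 * l))).unique hsum
    rw [hF] at heq
    change κ * firstPassage (innerWeight κ r) + κ * innerWeight κ r ^ (2 * l) * R + _ - _ - _ = 0
      at heq
    linear_combination heq - κ * h2
  · intro heq
    have hα' : innerWeight κ r ^ (2 * l) ≠ 0 := by positivity
    refine ⟨hr, _, _, (islandPassage (innerWeight κ r) (weightRatio κ c r) l -
      firstPassage (innerWeight κ r)) / innerWeight κ r ^ (2 * l), rfl, rfl, ?_, ?_⟩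
    · rw [← hasSum_mul_left_iff hα', mul_div_cancel₀ _ hα']
      exact hsum
    · rw [hF]
      change κ * firstPassage (innerWeight κ r) + κ * innerWeight κ r ^ (2 * l) * _ + _ - _ - _ = 0
      rw [mul_assoc, mul_div_cancel₀ _ hα']
      linarith

end

/-- Weierstrass test: the inner weight decreases in r, so the passage terms at r₀ dominate. -/
lemma continuousOn_islandPassage {κ c r₀ : ℝ} (hκ : 0 < κ) (hc : 0 ≤ c) (hr : 0 < r₀) (l : ℕ) :
    ContinuousOn (fun r => islandPassage (innerWeight κ r) (weightRatio κ c r) l)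
      (Set.Ici r₀) := by
  have hα : ContinuousOn (innerWeight κ) (Set.Ici r₀) :=
    ContinuousOn.div (by fun_prop) (by fun_prop) fun r hr' => by
      have := Set.mem_Ici.1 hr'
      linarith
  have hq : ContinuousOn (weightRatio κ c) (Set.Ici r₀) :=
    ContinuousOn.div (by fun_prop) (by fun_prop) fun r hr' => by
      have := Set.mem_Ici.1 hr'
      linarith
  refine continuousOn_tsum (u := passageTerm (innerWeight κ r₀)) (fun n => ?_)
    (summable_passageTerm (innerWeight_pos hκ hr).le (innerWeight_lt hκ hr)) fun n r hr' => ?_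
  · exact (continuousOn_const.mul (hα.pow _)).mul (hq.pow _)
  · have hle := Set.mem_Ici.1 hr'
    have hr1 : 0 < r := hr.trans_le hle
    rw [Real.norm_of_nonneg (islandTerm_nonneg (innerWeight_pos hκ hr1).le
      (weightRatio_nonneg hκ hc hr1) l n)]
    refine (islandTerm_le (innerWeight_pos hκ hr1).le (weightRatio_nonneg hκ hc hr1)
      (weightRatio_le_one hκ hc hr1) l n).trans ?_
    unfold passageTerm
    refine mul_le_mul_of_nonneg_left (pow_le_pow_left₀ (innerWeight_pos hκ hr1).le ?_ _)
      (Nat.cast_nonneg _)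
    unfold innerWeight
    gcongr

/-- Without killing (formally l = ∞) the left side of the equation tends to Λ > 0 as r → 0, so it is
positive at some r₀ > 0. A long enough partial sum keeps it positive, and this partial sum is below
F_l. At r₀ + Λ it is negative since F_l < 1; a root lies in between. -/
theorem admissibleSizes_nonempty {κ Λ c : ℝ} (hκ : 0 < κ) (hΛ : 0 < Λ) (hc : 0 ≤ c) :
    (admissibleSizes κ Λ c).Nonempty := by
  obtain ⟨r₀, hr0, hpos⟩ : ∃ r₀ : ℝ, 0 < r₀ ∧
      0 < κ * firstPassage (innerWeight κ r₀) + Λ - κ - r₀ := by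
    have hcont : ContinuousAt (fun r => κ * firstPassage (innerWeight κ r) + Λ - κ - r) 0 := by
      have h1 : ContinuousAt (innerWeight κ) 0 :=
        ContinuousAt.div (by fun_prop) (by fun_prop) (by simpa using hκ.ne')
      have h2 : Continuous firstPassage := by
        unfold firstPassage
        refine Continuous.div (by fun_prop) (by fun_prop) fun x => ?_
        positivity
      have h3 := h2.continuousAt.comp h1
      exact ((((continuousAt_const.mul h3).add continuousAt_const).sub continuousAt_const).sub
        continuousAt_id)
    have h0 : κ * firstPassage (innerWeight κ 0) + Λ - κ - 0 = Λ := by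
      have : innerWeight κ 0 = 1 / 2 := by
        unfold innerWeight
        field_simp
        simp
      rw [this]
      norm_num [firstPassage]
    have h4 : ∀ᶠ r in 𝓝 (0 : ℝ), 0 < κ * firstPassage (innerWeight κ r) + Λ - κ - r :=
      hcont.eventually (lt_mem_nhds (by simpa only [h0] using hΛ))
    obtain ⟨r, h5, h6⟩ := ((h4.filter_mono nhdsWithin_le_nhds).and
      (self_mem_nhdsWithin : Set.Ioi (0 : ℝ) ∈ 𝓝[>] 0)).exists
    exact ⟨r, h6, h5⟩
  have hα := innerWeight_pos hκ hr0
  have hα' := innerWeight_lt hκ hr0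
  obtain ⟨l, hl0, hl⟩ : ∃ l : ℕ, 0 < l ∧
      0 < κ * ∑ n ∈ Finset.range l, passageTerm (innerWeight κ r₀) n + Λ - κ - r₀ := by
    have h1 := (((((hasSum_passageTerm hα.le hα').tendsto_sum_nat).const_mul κ).add_const
      Λ).sub_const κ).sub_const r₀
    obtain ⟨l, h2, h3⟩ := ((h1.eventually (lt_mem_nhds hpos)).and (eventually_gt_atTop 0)).exists
    exact ⟨l, h3, h2⟩
  refine ⟨l, hl0, ?_⟩
  have hcont : ContinuousOn (fun r => κ * islandPassage (innerWeight κ r) (weightRatio κ c r) l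
      + Λ - κ - r) (Set.Icc r₀ (r₀ + Λ)) :=
    ((((continuousOn_const.mul (continuousOn_islandPassage hκ hc hr0 l)).add
      continuousOn_const).sub continuousOn_const).sub continuousOn_id).mono Set.Icc_subset_Ici_self
  have hr1 : 0 < r₀ + Λ := by positivity
  have hlo := sum_range_le_islandPassage hα.le hα' (weightRatio_nonneg hκ hc hr0)
    (weightRatio_le_one hκ hc hr0) l
  have hhi := (islandPassage_le (innerWeight_pos hκ hr1).le (innerWeight_lt hκ hr1)
    (weightRatio_nonneg hκ hc hr1) (weightRatio_le_one hκ hc hr1) l).trans_lt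
    (firstPassage_lt_one (innerWeight_pos hκ hr1).le (innerWeight_lt hκ hr1))
  obtain ⟨r, hr, hroot⟩ := intermediate_value_Icc' (by linarith) hcont
    (show (0 : ℝ) ∈ Set.Icc _ _ by
      constructor
      · nlinarith [mul_lt_mul_of_pos_left hhi hκ]
      · nlinarith [mul_le_mul_of_nonneg_left hlo hκ.le])
  exact ⟨r, (isPositiveSolution_iff hκ hc (hr0.trans_le hr.1)).2 hroot⟩

end BRW
end

/-! ### Semigroups of bounded nonpositive self-adjoint operators. -/

noncomputable section

section Semigroup

open NormedSpace

variable {E : Type*} [NormedAddCommGroup E] [InnerProductSpace ℝ E] [CompleteSpace E]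

namespace ContinuousLinearMap

lemma hasDerivAt_exp_smul_apply (A : E →L[ℝ] E) (w : E) (t : ℝ) :
    HasDerivAt (fun s : ℝ => exp (s • A) w) (A (exp (t • A) w)) t :=
  ((ContinuousLinearMap.apply ℝ E w).hasFDerivAt.comp_hasDerivAt t
    (hasDerivAt_exp_smul_const' A t) : _)

omit [CompleteSpace E] in
lemma exp_smul_apply_comm (A : E →L[ℝ] E) (w : E) (t : ℝ) :
    exp (t • A) (A w) = A (exp (t • A) w) := by
  have h : Commute (exp (t • A)) A := ((Commute.refl A).smul_left t).exp_left
  exact congrArg (fun T : E →L[ℝ] E => T w) h.eq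

lemma exp_smul_add_smul_one (A : E →L[ℝ] E) (r t : ℝ) :
    exp (t • (A + r • (1 : E →L[ℝ] E))) = Real.exp (r * t) • exp (t • A) := by
  let _ : NormedAlgebra ℚ (E →L[ℝ] E) := .restrictScalars ℚ ℝ _
  have h : Commute (t • A) ((r * t) • (1 : E →L[ℝ] E)) :=
    ((Commute.one_right A).smul_left t).smul_right (r * t)
  have h2 : exp ((r * t) • (1 : E →L[ℝ] E)) = Real.exp (r * t) • (1 : E →L[ℝ] E) := by
    rw [← Algebra.algebraMap_eq_smul_one, ← Algebra.algebraMap_eq_smul_one, Real.exp_eq_exp_ℝ,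
      algebraMap_exp_comm]
  rw [smul_add, smul_smul, mul_comm t r, exp_add_of_commute h, h2, mul_smul_comm, mul_one]

lemma norm_exp_smul_apply_antitone {A : E →L[ℝ] E} (hA : ∀ f, inner ℝ (A f) f ≤ 0) (w : E) :
    Antitone fun t : ℝ => ‖exp (t • A) w‖ ^ 2 := by
  refine antitone_of_hasDerivAt_nonpos (fun t => (hasDerivAt_exp_smul_apply A w t).norm_sq) ?_
  intro t
  have := hA (exp (t • A) w)
  rw [real_inner_comm] at this
  simp only [Pi.zero_apply]
  linarith

lemma norm_exp_smul_apply_le {A : E →L[ℝ] E} (hA : ∀ f, inner ℝ (A f) f ≤ 0) {t : ℝ} (ht : 0 ≤ t)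
    (w : E) : ‖exp (t • A) w‖ ≤ ‖w‖ := by
  have h := norm_exp_smul_apply_antitone hA w ht
  simp only [zero_smul, exp_zero] at h
  exact le_of_sq_le_sq h (norm_nonneg _)

/-- The range of a nonpositive self-adjoint operator is contracted to zero by its semigroup. -/
lemma tendsto_exp_smul_apply_range {A : E →L[ℝ] E} (hA : ∀ f, inner ℝ (A f) f ≤ 0)
    (hs : ∀ f g, inner ℝ (A f) g = inner ℝ f (A g)) (w : E) :
    Tendsto (fun t : ℝ => exp (t • A) (A w)) atTop (𝓝 0) := by
  -- Energy estimate: with u(t) = exp(tA) w, the nonpositive quantity ⟨A u, u⟩ has derivative 2‖A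
  -- u‖², which is nonincreasing, so 2T‖A u(T)‖² ≤ -⟨A w, w⟩.
  have hbound : ∀ t : ℝ, 0 < t → ‖exp (t • A) (A w)‖ ^ 2 ≤ -inner ℝ (A w) w / 2 * t⁻¹ := by
    intro T hT
    have hd : ∀ t, HasDerivAt (fun s : ℝ => inner ℝ (A (exp (s • A) w)) (exp (s • A) w))
        (2 * ‖exp (t • A) (A w)‖ ^ 2) t := by
      intro t
      have h1 := hasDerivAt_exp_smul_apply A w t
      have h2 := (A.hasFDerivAt.comp_hasDerivAt t h1).inner ℝ h1
      refine h2.congr_deriv ?_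
      simp only [Function.comp_apply]
      rw [hs (A _), real_inner_self_eq_norm_sq, exp_smul_apply_comm]
      ring
    have h3 := (convex_Icc 0 T).mul_sub_le_image_sub_of_le_deriv
      (fun t _ => (hd t).continuousAt.continuousWithinAt)
      (fun t _ => (hd t).differentiableAt.differentiableWithinAt)
      (C := 2 * ‖exp (T • A) (A w)‖ ^ 2) (fun t ht => by
        rw [(hd t).deriv]
        rw [interior_Icc] at ht
        have := norm_exp_smul_apply_antitone hA (A w) ht.2.le
        simp only at this
        linarith) 0 ⟨le_rfl, hT.le⟩ T ⟨hT.le, le_rfl⟩ hT.le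
    have h4 := hA (exp (T • A) w)
    have h5 : (1 : E →L[ℝ] E) w = w := rfl
    simp only [zero_smul, exp_zero, h5] at h3
    rw [← div_eq_mul_inv, le_div_iff₀ hT]
    linarith
  have hlim : Tendsto (fun t : ℝ => -inner ℝ (A w) w / 2 * t⁻¹) atTop (𝓝 0) := by
    simpa using tendsto_inv_atTop_zero.const_mul (-inner ℝ (A w) w / 2)
  have hsq : Tendsto (fun t : ℝ => ‖exp (t • A) (A w)‖ ^ 2) atTop (𝓝 0) :=
    tendsto_of_tendsto_of_tendsto_of_le_of_le' tendsto_const_nhds hlim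
      (Eventually.of_forall fun t => sq_nonneg _)
      ((eventually_gt_atTop 0).mono hbound)
  rw [tendsto_zero_iff_norm_tendsto_zero]
  simpa [Real.sqrt_sq (norm_nonneg _)] using hsq.sqrt

lemma exp_smul_apply_of_mem_ker {A : E →L[ℝ] E} {ψ : E} (hψ : A ψ = 0) (t : ℝ) :
    exp (t • A) ψ = ψ := by
  have hd : ∀ s, HasDerivAt (fun s : ℝ => exp (s • A) ψ) 0 s := fun s => by
    refine (hasDerivAt_exp_smul_apply A ψ s).congr_deriv ?_
    rw [← exp_smul_apply_comm, hψ, map_zero]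
  have := is_const_of_deriv_eq_zero (fun s => (hd s).differentiableAt) (fun s => (hd s).deriv) t 0
  simpa using this

/-- The semigroup of a nonpositive self-adjoint operator with one-dimensional kernel converges
strongly to the orthogonal projection on the kernel. -/
theorem tendsto_exp_smul_apply_of_ker {A : E →L[ℝ] E} (hA : ∀ f, inner ℝ (A f) f ≤ 0)
    (hs : ∀ f g, inner ℝ (A f) g = inner ℝ f (A g)) {ψ : E} (hψ : A ψ = 0) (hψ0 : ψ ≠ 0)
    (hker : ∀ f, A f = 0 → ∃ a : ℝ, f = a • ψ) (w : E) :
    Tendsto (fun t : ℝ => exp (t • A) w) atTop (𝓝 ((inner ℝ ψ w / ‖ψ‖ ^ 2) • ψ)) := by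
  set p : E := (inner ℝ ψ w / ‖ψ‖ ^ 2) • ψ with hp
  have hortho : inner ℝ ψ (w - p) = 0 := by
    have : ‖ψ‖ ≠ 0 := norm_ne_zero_iff.2 hψ0
    rw [inner_sub_right, hp, inner_smul_right, real_inner_self_eq_norm_sq]
    field_simp
    ring
  -- For self-adjoint A the closure of the range is the orthogonal complement of the kernel, here of
  -- ψ.
  have hmem : w - p ∈ closure (Set.range A) := by
    have h1 : w - p ∈ A.rangeᗮᗮ := by
      rw [Submodule.mem_orthogonal]
      intro u hu
      rw [Submodule.mem_orthogonal] at hu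
      have hAu : A u = 0 := by
        refine ext_inner_left ℝ fun f => ?_
        rw [← hs, inner_zero_right]
        exact hu (A f) ⟨f, rfl⟩
      obtain ⟨a, rfl⟩ := hker u hAu
      rw [inner_smul_left, hortho, mul_zero]
    rw [Submodule.orthogonal_orthogonal_eq_closure] at h1
    exact h1
  -- Convergence on the range extends to its closure because the semigroup is contractive.
  have hlim : Tendsto (fun t : ℝ => exp (t • A) (w - p)) atTop (𝓝 0) := by
    rw [Metric.tendsto_nhds]
    intro ε hε
    obtain ⟨_, ⟨u, rfl⟩, hu⟩ := Metric.mem_closure_iff.1 hmem (ε / 2) (by positivity)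
    have h2 := (Metric.tendsto_nhds.1 (tendsto_exp_smul_apply_range hA hs u)) (ε / 2)
      (by positivity)
    filter_upwards [h2, eventually_ge_atTop 0] with t ht ht0
    rw [dist_zero_right] at ht ⊢
    have h3 := norm_exp_smul_apply_le hA ht0 (w - p - A u)
    rw [map_sub] at h3
    rw [dist_eq_norm] at hu
    have h4 := norm_sub_norm_le (exp (t • A) (w - p)) (exp (t • A) (A u))
    linarith
  have h5 := hlim.add_const p
  rw [zero_add] at h5
  refine h5.congr fun t => ?_
  have h6 : exp (t • A) p = p := by rw [hp, map_smul, exp_smul_apply_of_mem_ker hψ]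
  rw [map_sub, h6, sub_add_cancel]

end ContinuousLinearMap
end Semigroup
end

/-! ### The lattice Schrödinger operator and its Green function. -/

noncomputable section

namespace BRW

/-- The Hilbert space of square summable functions on the lattice. -/
abbrev LatticeL2 : Type := lp (fun _ : ℤ => ℝ) 2

namespace LatticeL2

lemma memℓp_iff {f : ℤ → ℝ} : Memℓp (E := fun _ : ℤ => ℝ) f 2 ↔ Summable fun z => f z ^ 2 := by
  rw [memℓp_gen_iff (by norm_num)]
  simp

lemma summable_sq (f : LatticeL2) : Summable fun z => f z ^ 2 := memℓp_iff.1 (lp.memℓp f)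

lemma inner_eq (f g : LatticeL2) : inner ℝ f g = ∑' z, f z * g z := by
  rw [lp.inner_eq_tsum]
  exact tsum_congr fun z => mul_comm _ _

lemma norm_sq_eq (f : LatticeL2) : ‖f‖ ^ 2 = ∑' z, f z ^ 2 := by
  rw [← real_inner_self_eq_norm_sq, inner_eq]
  exact tsum_congr fun z => (sq _).symm

lemma abs_apply_le (f : LatticeL2) (z : ℤ) : |f z| ≤ ‖f‖ :=
  lp.norm_apply_le_norm (by norm_num) f z

/-- The unit vector at `x`. -/
def unit (x : ℤ) : LatticeL2 := lp.single 2 x 1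

lemma unit_apply (x z : ℤ) : unit x z = if z = x then 1 else 0 := by
  simp [unit, Pi.single_apply]

lemma inner_unit (x : ℤ) (f : LatticeL2) : inner ℝ f (unit x) = f x := by
  rw [unit, lp.inner_single_right]
  simp

lemma norm_unit (x : ℤ) : ‖unit x‖ = 1 := by
  rw [unit, lp.norm_single (by norm_num)]
  simp

lemma one_clm_apply (f : LatticeL2) : (1 : LatticeL2 →L[ℝ] LatticeL2) f = f := rfl

/-- Translation by `k`. -/
def shift (k : ℤ) : LatticeL2 →L[ℝ] LatticeL2 :=
  LinearMap.mkContinuous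
    { toFun := fun f => ⟨fun z => f (z + k),
        memℓp_iff.2 ((Equiv.addRight k).summable_iff.2 (summable_sq f))⟩
      map_add' := fun _ _ => rfl
      map_smul' := fun _ _ => rfl } 1 fun f => by
    rw [one_mul]
    refine le_of_sq_le_sq (le_of_eq ?_) (norm_nonneg _)
    rw [norm_sq_eq, norm_sq_eq]
    exact (Equiv.addRight k).tsum_eq fun z => f z ^ 2

lemma shift_apply (k : ℤ) (f : LatticeL2) (z : ℤ) : shift k f z = f (z + k) := rfl

lemma norm_shift_le (k : ℤ) (f : LatticeL2) : ‖shift k f‖ ≤ ‖f‖ := by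
  have := (shift k).le_of_opNorm_le (LinearMap.mkContinuous_norm_le _ zero_le_one _) f
  rwa [one_mul] at this

lemma inner_shift_left (k : ℤ) (f g : LatticeL2) :
    inner ℝ (shift k f) g = inner ℝ f (shift (-k) g) := by
  rw [inner_eq, inner_eq, ← (Equiv.addRight (-k)).tsum_eq]
  refine tsum_congr fun z => ?_
  simp [shift_apply]

lemma summable_mul_sq {V : ℤ → ℝ} {C : ℝ} (hV : ∀ z, |V z| ≤ C) (f : LatticeL2) :
    Summable fun z => (V z * f z) ^ 2 := by
  refine ((summable_sq f).mul_left (C ^ 2)).of_nonneg_of_le (fun z => sq_nonneg _) fun z => ?_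
  rw [mul_pow, ← sq_abs (V z)]
  exact mul_le_mul_of_nonneg_right (pow_le_pow_left₀ (abs_nonneg _) (hV z) 2) (sq_nonneg _)

/-- Multiplication by a bounded function. -/
def mulOp (V : ℤ → ℝ) {C : ℝ} (hV : ∀ z, |V z| ≤ C) : LatticeL2 →L[ℝ] LatticeL2 :=
  LinearMap.mkContinuous
    { toFun := fun f => ⟨fun z => V z * f z, memℓp_iff.2 (summable_mul_sq hV f)⟩
      map_add' := fun f g => lp.ext <| funext fun z => mul_add (V z) (f z) (g z)
      map_smul' := fun a f => lp.ext <| funext fun z => mul_left_comm (V z) a (f z) } C fun f => by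
    refine le_of_sq_le_sq ?_ (mul_nonneg ((abs_nonneg _).trans (hV 0)) (norm_nonneg _))
    rw [mul_pow, norm_sq_eq, norm_sq_eq, ← tsum_mul_left]
    refine (summable_mul_sq hV f).tsum_le_tsum (fun z => ?_) ((summable_sq f).mul_left _)
    simp only [LinearMap.coe_mk, AddHom.coe_mk]
    rw [mul_pow, ← sq_abs (V z)]
    exact mul_le_mul_of_nonneg_right (pow_le_pow_left₀ (abs_nonneg _) (hV z) 2) (sq_nonneg _)

lemma mulOp_apply (V : ℤ → ℝ) {C : ℝ} (hV : ∀ z, |V z| ≤ C) (f : LatticeL2) (z : ℤ) :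
    mulOp V hV f z = V z * f z := rfl

/-- The lattice Schrödinger operator with diffusion coefficient `κ` and potential `V`. -/
def schrodinger (κ : ℝ) (V : ℤ → ℝ) {C : ℝ} (hV : ∀ z, |V z| ≤ C) : LatticeL2 →L[ℝ] LatticeL2 :=
  (κ / 2) • (shift 1 + shift (-1) - (2 : ℝ) • (1 : LatticeL2 →L[ℝ] LatticeL2)) + mulOp V hV

section

variable {κ : ℝ} {V : ℤ → ℝ} {C : ℝ} (hV : ∀ z, |V z| ≤ C)

lemma schrodinger_apply (f : LatticeL2) (z : ℤ) : schrodinger κ V hV f z =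
    κ / 2 * (f (z + 1) + f (z - 1) - 2 * f z) + V z * f z := rfl

lemma inner_schrodinger_left (f g : LatticeL2) :
    inner ℝ (schrodinger κ V hV f) g = inner ℝ f (schrodinger κ V hV g) := by
  have h1 : inner ℝ (mulOp V hV f) g = inner ℝ f (mulOp V hV g) := by
    rw [inner_eq, inner_eq]
    refine tsum_congr fun z => ?_
    rw [mulOp_apply, mulOp_apply]
    ring
  have h2 := inner_shift_left 1 f g
  have h3 := inner_shift_left (-1) f g
  rw [neg_neg] at h3
  simp only [schrodinger, _root_.add_apply, _root_.smul_apply,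
    _root_.sub_apply, one_clm_apply, inner_add_left, inner_add_right,
    inner_smul_left, inner_smul_right, inner_sub_left, inner_sub_right, h1, h2, h3,
    RCLike.conj_to_real]
  ring

/-- Translations are contractions, so Cauchy–Schwarz bounds each ⟨shift f, f⟩ by ‖f‖². -/
lemma inner_schrodinger_self_nonpos (hκ : 0 ≤ κ) (hV0 : ∀ z, V z ≤ 0) (f : LatticeL2) :
    inner ℝ (schrodinger κ V hV f) f ≤ 0 := by
  have h1 : inner ℝ (mulOp V hV f) f ≤ 0 := by
    rw [inner_eq]
    refine tsum_nonpos fun z => ?_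
    rw [mulOp_apply, mul_assoc]
    exact mul_nonpos_of_nonpos_of_nonneg (hV0 z) (mul_self_nonneg _)
  have h2 : ∀ k, inner ℝ (shift k f) f ≤ ‖f‖ ^ 2 := fun k =>
    (real_inner_le_norm _ _).trans (by
      rw [sq]
      exact mul_le_mul_of_nonneg_right (norm_shift_le k f) (norm_nonneg _))
  simp only [schrodinger, _root_.add_apply, _root_.smul_apply,
    _root_.sub_apply, one_clm_apply, inner_add_left,
    inner_smul_left, inner_sub_left, RCLike.conj_to_real, real_inner_self_eq_norm_sq]
  nlinarith [h2 1, h2 (-1)]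

/-- The minimum principle. -/
lemma nonneg_of_resolvent_nonneg (hκ : 0 ≤ κ) (hV0 : ∀ z, V z ≤ 0) {r : ℝ} (hr : 0 < r)
    {f : LatticeL2} (hf : ∀ z, 0 ≤ r * f z - schrodinger κ V hV f z) (z : ℤ) : 0 ≤ f z := by
  by_contra! hneg
  -- Square summable functions vanish at infinity, so a negative value forces a negative global
  -- minimum; there the discrete Laplacian is nonnegative and the hypothesis fails.
  have hfin : {y | f y ≤ f z}.Finite := by
    have h1 := (summable_sq f).tendsto_cofinite_zero.eventually
      (gt_mem_nhds (sq_pos_of_neg hneg))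
    refine (Filter.eventually_cofinite.1 h1).subset fun y hy => ?_
    have hy' : f y ≤ f z := hy
    rw [Set.mem_ofPred_eq, not_lt]
    nlinarith
  obtain ⟨m, hm, hmin⟩ := Set.exists_min_image _ (fun y => f y) hfin ⟨z, le_refl (f z)⟩
  have hall : ∀ y, f m ≤ f y := fun y => by
    rcases le_total (f y) (f z) with h | h
    · exact hmin y h
    · exact le_trans hm h
  have hfm : f m < 0 := lt_of_le_of_lt hm hneg
  have h2 := hf m
  rw [schrodinger_apply] at h2
  nlinarith [mul_nonneg hκ (sub_nonneg.2 (hall (m + 1))),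
    mul_nonneg hκ (sub_nonneg.2 (hall (m - 1))),
    mul_nonneg_of_nonpos_of_nonpos (hV0 m) hfm.le, mul_neg_of_pos_of_neg hr hfm]

open NormedSpace in
lemma exp_smul_apply_nonneg_of_positive {T : LatticeL2 →L[ℝ] LatticeL2}
    (hT : ∀ f : LatticeL2, (∀ z, 0 ≤ f z) → ∀ z, 0 ≤ T f z) {t : ℝ} (ht : 0 ≤ t)
    {f : LatticeL2} (hf : ∀ z, 0 ≤ f z) (z : ℤ) : 0 ≤ exp (t • T) f z := by
  have h1 := ((lp.evalCLM ℝ (fun _ : ℤ => ℝ) 2 z).comp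
    (ContinuousLinearMap.apply ℝ LatticeL2 f)).hasSum (exp_series_hasSum_exp' (𝕂 := ℝ) (t • T))
  refine h1.nonneg fun n => ?_
  have hpow : ∀ n : ℕ, ∀ y, 0 ≤ (T ^ n) f y := by
    intro n
    induction n with
    | zero => exact hf
    | succ n ih =>
      rw [pow_succ']
      exact hT _ ih
  have h2 : ((n.factorial : ℝ)⁻¹ • (t • T) ^ n) f z =
      (n.factorial : ℝ)⁻¹ * (t ^ n * (T ^ n) f z) := by
    rw [smul_pow]
    rfl
  exact le_of_le_of_eq (by have := hpow n z; positivity) h2.symm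

open NormedSpace in
-- Adding κ + C to the operator makes it positivity preserving and only multiplies the semigroup by
-- a positive scalar.
lemma exp_smul_schrodinger_nonneg (hκ : 0 ≤ κ) {t : ℝ} (ht : 0 ≤ t) {f : LatticeL2}
    (hf : ∀ z, 0 ≤ f z) (z : ℤ) : 0 ≤ exp (t • schrodinger κ V hV) f z := by
  have h1 : schrodinger κ V hV = (schrodinger κ V hV + (κ + C) • (1 : LatticeL2 →L[ℝ] LatticeL2)) +
      (-(κ + C)) • (1 : LatticeL2 →L[ℝ] LatticeL2) := by
    rw [neg_smul, add_neg_cancel_right]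
  rw [h1, ContinuousLinearMap.exp_smul_add_smul_one]
  refine mul_nonneg (Real.exp_nonneg _)
    (exp_smul_apply_nonneg_of_positive (fun g hg y => ?_) ht hf z)
  change 0 ≤ schrodinger κ V hV g y + (κ + C) * g y
  rw [schrodinger_apply]
  have h2 := (abs_le.1 (hV y)).1
  nlinarith [mul_nonneg hκ (hg (y + 1)), mul_nonneg hκ (hg (y - 1)),
    mul_nonneg (by linarith : 0 ≤ V y + C) (hg y)]

end

section

variable {κ : ℝ} {V : ℤ → ℝ} {C : ℝ} (hV : ∀ z, |V z| ≤ C)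

/-- This coercivity yields invertibility (Lax–Milgram), the bound on the Green function, and later
the simplicity of the top eigenvalue. -/
lemma inner_resolvent_ge (hκ : 0 ≤ κ) (hV0 : ∀ z, V z ≤ 0) (r : ℝ) (f : LatticeL2) :
    r * ‖f‖ ^ 2 ≤ inner ℝ ((r • (1 : LatticeL2 →L[ℝ] LatticeL2) - schrodinger κ V hV) f) f := by
  have h1 := inner_schrodinger_self_nonpos hV hκ hV0 f
  have h2 : (r • (1 : LatticeL2 →L[ℝ] LatticeL2) - schrodinger κ V hV) f =
    r • f - schrodinger κ V hV f := rfl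
  rw [h2, inner_sub_left, inner_smul_left, RCLike.conj_to_real, real_inner_self_eq_norm_sq]
  linarith

lemma isUnit_resolvent (hκ : 0 ≤ κ) (hV0 : ∀ z, V z ≤ 0) {r : ℝ} (hr : 0 < r) :
    IsUnit (r • (1 : LatticeL2 →L[ℝ] LatticeL2) - schrodinger κ V hV) := by
  refine ContinuousLinearMap.isUnit_of_forall_le_norm_inner_map _ (c := ⟨r, hr.le⟩) hr fun f => ?_
  have h1 := inner_resolvent_ge hV hκ hV0 r f
  rw [mul_comm]
  exact h1.trans (le_abs_self _)

/-- The resolvent at `r` applied to the unit vector at `0`. -/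
def green (κ : ℝ) (r : ℝ) : LatticeL2 :=
  Ring.inverse (r • (1 : LatticeL2 →L[ℝ] LatticeL2) - schrodinger κ V hV) (unit 0)

lemma green_spec (hκ : 0 ≤ κ) (hV0 : ∀ z, V z ≤ 0) {r : ℝ} (hr : 0 < r) :
    r • green hV κ r - schrodinger κ V hV (green hV κ r) = unit 0 :=
  congrArg (fun T : LatticeL2 →L[ℝ] LatticeL2 => T (unit 0))
    (Ring.mul_inverse_cancel _ (isUnit_resolvent hV hκ hV0 hr))

lemma green_spec_apply (hκ : 0 ≤ κ) (hV0 : ∀ z, V z ≤ 0) {r : ℝ} (hr : 0 < r) (z : ℤ) :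
    r * green hV κ r z - schrodinger κ V hV (green hV κ r) z = if z = 0 then 1 else 0 := by
  rw [← unit_apply, ← green_spec hV hκ hV0 hr]
  rfl

lemma continuousOn_green (hκ : 0 ≤ κ) (hV0 : ∀ z, V z ≤ 0) :
    ContinuousOn (fun r => green hV κ r 0) (Set.Ioi 0) := by
  intro r hr
  obtain ⟨u, hu⟩ := isUnit_resolvent hV hκ hV0 hr
  have h1 : ContinuousAt (fun r : ℝ => r • (1 : LatticeL2 →L[ℝ] LatticeL2) -
      schrodinger κ V hV) r :=
    by fun_prop
  have h2 := NormedRing.inverse_continuousAt u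
  rw [hu] at h2
  have h3 : ContinuousAt (fun r => green hV κ r) r :=
    ((ContinuousLinearMap.apply ℝ LatticeL2 (unit 0)).continuous.continuousAt).comp
      (ContinuousAt.comp (f := fun r : ℝ => r • (1 : LatticeL2 →L[ℝ] LatticeL2) -
        schrodinger κ V hV) h2 h1)
  exact (((lp.evalCLM ℝ (fun _ : ℤ => ℝ) 2 0).continuous.continuousAt).comp
    h3).continuousWithinAt

/-- Coercivity reads r‖G‖² ≤ G(0) ≤ ‖G‖, so ‖G‖ ≤ 1/r. -/
lemma green_zero_le (hκ : 0 ≤ κ) (hV0 : ∀ z, V z ≤ 0) {r : ℝ} (hr : 0 < r) :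
    green hV κ r 0 ≤ 1 / r := by
  have h1 := inner_resolvent_ge hV hκ hV0 r (green hV κ r)
  have h2 : (r • (1 : LatticeL2 →L[ℝ] LatticeL2) - schrodinger κ V hV) (green hV κ r) = unit 0 :=
    green_spec hV hκ hV0 hr
  rw [h2, real_inner_comm, inner_unit] at h1
  have h3 := (le_abs_self _).trans (abs_apply_le (green hV κ r) 0)
  rw [le_div_iff₀ hr]
  have h4 : r * ‖green hV κ r‖ ≤ 1 := by
    by_contra! h
    have : 0 < ‖green hV κ r‖ := by
      by_contra! h'
      nlinarith
    nlinarith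
  nlinarith

/-- The minimum principle applied to b G - φ: subsolutions lie below the Green function. -/
lemma le_mul_green (hκ : 0 ≤ κ) (hV0 : ∀ z, V z ≤ 0) {r : ℝ} (hr : 0 < r) {φ : LatticeL2} {b : ℝ}
    (hφ : ∀ z, r * φ z - schrodinger κ V hV φ z ≤ if z = 0 then b else 0) (z : ℤ) :
    φ z ≤ b * green hV κ r z := by
  have h1 := nonneg_of_resolvent_nonneg hV hκ hV0 hr (f := b • green hV κ r - φ) (fun y => by
    have h2 := green_spec_apply hV hκ hV0 hr y
    have h3 := hφ y
    rw [map_sub, map_smul]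
    change 0 ≤ r * (b * green hV κ r y - φ y) -
      (b * schrodinger κ V hV (green hV κ r) y - schrodinger κ V hV φ y)
    have h4 := congrArg (b * ·) h2
    simp only at h4
    split_ifs at h3 h4 <;> linarith) z
  exact sub_nonneg.1 h1

/-- At a zero of the nonnegative G the resolvent equation forces both neighbours to vanish; hence
positivity spreads outwards from 0. -/
lemma green_pos (hκ : 0 < κ) (hV0 : ∀ z, V z ≤ 0) {r : ℝ} (hr : 0 < r)
    (h0 : 0 < green hV κ r 0) (z : ℤ) : 0 < green hV κ r z := by
  have hnn : ∀ y, 0 ≤ green hV κ r y := nonneg_of_resolvent_nonneg hV hκ.le hV0 hr fun y => by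
    rw [green_spec_apply hV hκ.le hV0 hr]
    split_ifs <;> norm_num
  have hstep : ∀ y, 0 < green hV κ r (y + 1) + green hV κ r (y - 1) → 0 < green hV κ r y := by
    intro y hy
    refine (hnn y).lt_of_ne fun h => ?_
    have h1 := green_spec_apply hV hκ.le hV0 hr y
    rw [schrodinger_apply, ← h] at h1
    have h2 : (0 : ℝ) ≤ if y = 0 then 1 else 0 := by split_ifs <;> norm_num
    nlinarith [mul_pos hκ hy]
  induction z using Int.induction_on with
  | zero => exact h0
  | succ n ih => exact hstep _ (by rw [add_sub_cancel_right]; linarith [hnn (n + 1 + 1)])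
  | pred n ih => exact hstep _ (by rw [sub_add_cancel]; linarith [hnn (-n - 1 - 1)])

/-- Intermediate values between r₀ and max r₀ Λ, where the bound G_r(0) ≤ 1/r gives Λ G_r(0) ≤ 1. -/
theorem exists_green_eq (hκ : 0 ≤ κ) (hV0 : ∀ z, V z ≤ 0) {Λ r₀ : ℝ} (hΛ : 0 < Λ) (hr₀ : 0 < r₀)
    (h : 1 ≤ Λ * green hV κ r₀ 0) : ∃ r, 0 < r ∧ Λ * green hV κ r 0 = 1 := by
  have h1 := green_zero_le hV hκ hV0 (show 0 < max r₀ Λ by positivity)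
  have h2 : 1 / max r₀ Λ ≤ 1 / Λ := one_div_le_one_div_of_le hΛ (le_max_right _ _)
  have h3 : Λ * green hV κ (max r₀ Λ) 0 ≤ 1 := by
    have := mul_le_mul_of_nonneg_left (h1.trans h2) hΛ.le
    rwa [mul_one_div_cancel hΛ.ne'] at this
  obtain ⟨r, hr, hr'⟩ := intermediate_value_Icc' (le_max_left r₀ Λ)
    (continuousOn_const.mul ((continuousOn_green hV hκ hV0).mono fun r hr => hr₀.trans_le hr.1))
    (show (1 : ℝ) ∈ Set.Icc _ _ from ⟨h3, h⟩)
  exact ⟨r, hr₀.trans_le hr.1, hr'⟩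

open NormedSpace in
/-- Asymptotics of the semigroup of a rank one perturbation with a positive eigenvalue. -/
theorem tendsto_exp_smul_schrodinger (hκ : 0 ≤ κ) (hV0 : ∀ z, V z ≤ 0) {W : ℤ → ℝ} {D : ℝ}
    (hW : ∀ z, |W z| ≤ D) {Λ : ℝ} (hWV : ∀ z, W z = V z + if z = 0 then Λ else 0) {r : ℝ}
    (hr : 0 < r) (hg : Λ * green hV κ r 0 = 1) (x y : ℤ) :
    Tendsto (fun t : ℝ => exp (t • schrodinger κ W hW) (unit x) y / Real.exp (r * t)) atTop
      (𝓝 (green hV κ r x * green hV κ r y / ‖green hV κ r‖ ^ 2)) := by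
  set ψ := green hV κ r with hψ
  have hrank : ∀ f : LatticeL2, schrodinger κ W hW f =
      schrodinger κ V hV f + (Λ * f 0) • unit 0 := by
    intro f
    refine lp.ext (funext fun z => ?_)
    change schrodinger κ W hW f z = schrodinger κ V hV f z + Λ * f 0 * unit 0 z
    rw [schrodinger_apply, schrodinger_apply, hWV, unit_apply]
    split_ifs with h
    · rw [h]; ring
    · ring
  have hspec := green_spec hV hκ hV0 hr
  rw [← hψ] at hspec
  set A : LatticeL2 →L[ℝ] LatticeL2 :=
    schrodinger κ W hW + (-r) • (1 : LatticeL2 →L[ℝ] LatticeL2) with hA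
  have hAapp : ∀ f, A f = schrodinger κ V hV f + (Λ * f 0) • unit 0 - r • f := by
    intro f
    rw [← hrank, hA]
    change schrodinger κ W hW f + (-r) • f = schrodinger κ W hW f - r • f
    rw [neg_smul, sub_eq_add_neg]
  have hAψ : A ψ = 0 := by
    rw [hAapp, hg, ← hspec, one_smul]
    abel
  have hψ0 : ψ ≠ 0 := by
    intro h
    rw [h] at hg
    change Λ * 0 = 1 at hg
    rw [mul_zero] at hg
    exact zero_ne_one hg
  have hAs : ∀ f g, inner ℝ (A f) g = inner ℝ f (A g) := by
    intro f g
    change inner ℝ (schrodinger κ W hW f + (-r) • f) g =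
      inner ℝ f (schrodinger κ W hW g + (-r) • g)
    rw [inner_add_left, inner_add_right, inner_schrodinger_left, inner_smul_left, inner_smul_right,
      RCLike.conj_to_real]
  -- With g = f - Λ f(0) ψ this says (r - H₀) g = -A f. Since A ψ = 0 and A is symmetric, coercivity
  -- becomes r‖g‖² ≤ -⟨A f, f⟩: A is nonpositive, and A f = 0 forces g = 0.
  have hres : ∀ f : LatticeL2, (r • (1 : LatticeL2 →L[ℝ] LatticeL2) - schrodinger κ V hV)
      (f - (Λ * f 0) • ψ) = -A f := by
    intro f
    change r • (f - (Λ * f 0) • ψ) - schrodinger κ V hV (f - (Λ * f 0) • ψ) = _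
    rw [map_sub, map_smul, hAapp, ← hspec]
    module
  have hAneg : ∀ f, inner ℝ (A f) f ≤ 0 := by
    intro f
    have h1 := inner_resolvent_ge hV hκ hV0 r (f - (Λ * f 0) • ψ)
    rw [hres, inner_neg_left, inner_sub_right, inner_smul_right, hAs f ψ, hAψ, inner_zero_right,
      mul_zero, sub_zero] at h1
    have : 0 ≤ r * ‖f - (Λ * f 0) • ψ‖ ^ 2 := by positivity
    linarith
  have hker : ∀ f, A f = 0 → ∃ a : ℝ, f = a • ψ := by
    intro f hf
    refine ⟨Λ * f 0, ?_⟩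
    have h1 := inner_resolvent_ge hV hκ hV0 r (f - (Λ * f 0) • ψ)
    rw [hres, hf, neg_zero, inner_zero_left] at h1
    have h3 : ‖f - (Λ * f 0) • ψ‖ ^ 2 = 0 := by
      have : 0 ≤ ‖f - (Λ * f 0) • ψ‖ ^ 2 := sq_nonneg _
      nlinarith
    exact sub_eq_zero.1 (norm_eq_zero.1 (pow_eq_zero_iff two_ne_zero |>.1 h3))
  have hlim := ContinuousLinearMap.tendsto_exp_smul_apply_of_ker hAneg hAs hAψ hψ0 hker (unit x)
  have hlim2 := ((lp.evalCLM ℝ (fun _ : ℤ => ℝ) 2 y).continuous.tendsto _).comp hlim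
  rw [inner_unit] at hlim2
  have hval : lp.evalCLM ℝ (fun _ : ℤ => ℝ) 2 y ((ψ x / ‖ψ‖ ^ 2) • ψ) = ψ x * ψ y / ‖ψ‖ ^ 2 := by
    rw [map_smul]
    change ψ x / ‖ψ‖ ^ 2 * ψ y = _
    ring
  rw [hval] at hlim2
  refine hlim2.congr fun t => ?_
  rw [Function.comp_apply, hA, ContinuousLinearMap.exp_smul_add_smul_one]
  change Real.exp (-r * t) * exp (t • schrodinger κ W hW) (unit x) y = _
  rw [neg_mul, Real.exp_neg]
  ring

end

/-! ### The subsolution attached to an island. -/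

/-- The radial profile of the subsolution for an island of size `l`. -/
def islandProfile (α q : ℝ) (l : ℕ) : ℕ → ℝ
  | 0 => 1
  | k + 1 => islandProfile α q l k * islandPassage α q (l - k)

section

variable {α q : ℝ} (h0 : 0 ≤ α) (h1 : α < 1 / 2) (hq0 : 0 ≤ q) (hq1 : q ≤ 1)

include h0 hq0 in
lemma islandProfile_nonneg (l k : ℕ) : 0 ≤ islandProfile α q l k := by
  induction k with
  | zero => exact zero_le_one
  | succ k ih => exact mul_nonneg ih (islandPassage_nonneg h0 hq0 _)

include h0 h1 hq0 hq1 in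
lemma islandProfile_le (l k : ℕ) : islandProfile α q l k ≤ firstPassage α ^ k := by
  induction k with
  | zero => simp [islandProfile]
  | succ k ih =>
    rw [pow_succ]
    exact mul_le_mul ih (islandPassage_le h0 h1 hq0 hq1 _) (islandPassage_nonneg h0 hq0 _)
      (pow_nonneg (firstPassage_nonneg h0) _)

include h0 h1 hq0 hq1 in
lemma memℓp_islandProfile (l : ℕ) :
    Memℓp (E := fun _ : ℤ => ℝ) (fun z : ℤ => islandProfile α q l z.natAbs) 2 := by
  have hρ0 := firstPassage_nonneg h0
  have hρ1 := firstPassage_lt_one h0 h1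
  have hs : Summable fun k : ℕ => islandProfile α q l k ^ 2 := by
    refine (summable_geometric_of_lt_one hρ0 hρ1).of_nonneg_of_le (fun k => sq_nonneg _) fun k => ?_
    have h2 := islandProfile_le h0 h1 hq0 hq1 l k
    have h3 := islandProfile_nonneg h0 hq0 l k
    have h4 : firstPassage α ^ k ≤ 1 := pow_le_one₀ hρ0 hρ1.le
    nlinarith
  rw [memℓp_iff]
  exact Summable.of_nat_of_neg (by simpa using hs) (by simpa using hs)

end

/-- A solution of the island equation bounds the Green function at the source from below. -/
theorem one_le_mul_green {κ Λ c r : ℝ} {l : ℕ} {V : ℤ → ℝ} {C : ℝ} (hV : ∀ z, |V z| ≤ C)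
    (hκ : 0 < κ) (hc : 0 ≤ c) (hr : 0 < r) (hV0 : ∀ z, V z ≤ 0) (hVc : ∀ z, -c ≤ V z)
    (hVl : ∀ z : ℤ, z.natAbs ≤ l → V z = 0)
    (heq : κ * islandPassage (innerWeight κ r) (weightRatio κ c r) l + Λ - κ - r = 0) :
    1 ≤ Λ * green hV κ r 0 := by
  have hα := innerWeight_pos hκ hr
  have hα' := innerWeight_lt hκ hr
  have hq0 := weightRatio_nonneg hκ hc hr
  have hq1 := weightRatio_le_one hκ hc hr
  have hβ := weightRatio_mul_innerWeight hκ hc hr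
  have hαr : innerWeight κ r * (κ + r) = κ / 2 := by
    unfold innerWeight
    field_simp
  set α := innerWeight κ r
  set q := weightRatio κ c r
  have hβ' : q * α * (c + κ + r) = κ / 2 := by
    rw [hβ]
    field_simp
  let φ : LatticeL2 := ⟨_, memℓp_islandProfile hα.le hα' hq0 hq1 l⟩
  have hφ : ∀ z, φ z = islandProfile α q l z.natAbs := fun _ => rfl
  -- As φ(0) = 1, it remains to check (r - H₀) φ ≤ Λ δ₀. At the origin equality holds: this is the
  -- island equation.
  have h1 := le_mul_green hV hκ.le hV0 hr (φ := φ) (b := Λ) (fun z => by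
    rw [schrodinger_apply, hφ, hφ, hφ]
    split_ifs with hz
    · subst hz
      simp only [zero_add, zero_sub, Int.natAbs_neg, Int.natAbs_one, Int.natAbs_zero,
        islandProfile, Nat.sub_zero, hVl 0 (by simp)]
      linarith
    · obtain ⟨j, hj⟩ : ∃ j, z.natAbs = j + 1 := Nat.exists_eq_succ_of_ne_zero (by simpa using hz)
      have hsum : islandProfile α q l (z + 1).natAbs + islandProfile α q l (z - 1).natAbs =
          islandProfile α q l (j + 2) + islandProfile α q l j := by
        rcases lt_or_gt_of_ne hz with h | h
        · rw [show (z + 1).natAbs = j by omega, show (z - 1).natAbs = j + 2 by omega, add_comm]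
        · rw [show (z + 1).natAbs = j + 2 by omega, show (z - 1).natAbs = j by omega]
      rw [hsum, hj]
      have hP := islandProfile_nonneg hα.le hq0 l j
      simp only [islandProfile]
      -- After factoring out the profile at distance j: inside the island the recursion for F_l
      -- applies; beyond it truncated subtraction makes every further ratio F_0, which solves the
      -- quadratic for β, that is, for the maximal killing c ≥ -V.
      by_cases hjl : j < l
      · obtain ⟨m, hm⟩ : ∃ m, l - j = m + 1 := ⟨l - j - 1, by omega⟩
        rw [hVl z (by omega), show l - (j + 1) = m by omega, hm]
        have h2 := islandPassage_succ_le hα.le hα' hq0 hq1 m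
        have h3 : (κ + r) * islandPassage α q (m + 1) ≤
            κ / 2 * (1 + islandPassage α q m * islandPassage α q (m + 1)) := by
          rw [← hαr]
          have := mul_le_mul_of_nonneg_left h2 (by positivity : 0 ≤ κ + r)
          linarith
        have h4 := mul_le_mul_of_nonneg_left h3 hP
        linarith
      · rw [show l - (j + 1) = 0 by omega, show l - j = 0 by omega]
        have h2 : islandPassage α q 0 = q * α + q * α * islandPassage α q 0 ^ 2 := by
          rw [islandPassage_zero hα.le hα' hq0 hq1]
          exact firstPassage_quadratic (by positivity)
            ((mul_le_of_le_one_left hα.le hq1).trans_lt hα')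
        have hS := islandPassage_nonneg (l := 0) hα.le hq0
        have h3 : (κ + r - V z) * islandPassage α q 0 ≤ κ / 2 * (1 + islandPassage α q 0 ^ 2) := by
          refine (mul_le_mul_of_nonneg_right (by linarith [hVc z] :
            κ + r - V z ≤ c + κ + r) hS).trans (le_of_eq ?_)
          rw [← hβ']
          linear_combination (c + κ + r) * h2
        have h4 := mul_le_mul_of_nonneg_left h3 hP
        linarith) 0
  rwa [hφ] at h1

end LatticeL2

/-! ### Independence of the marks and the law of the start of a particle. -/

instance : IsProbabilityMeasure markLaw := by
  have : IsProbabilityMeasure (expMeasure 1) := isProbabilityMeasure_expMeasure zero_lt_one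
  unfold markLaw
  infer_instance

instance : IsProbabilityMeasure marksLaw := by
  unfold marksLaw
  infer_instance

/-- The law of the driving randomness is invariant under resampling the mark of one label. -/
lemma map_update_marksLaw (v : Label) :
    (marksLaw.prod markLaw).map (fun p => Function.update p.1 v p.2) = marksLaw := by
  have hmeas : Measurable fun p : Marks × (ℝ × I) => Function.update p.1 v p.2 :=
    measurable_update'
  refine Measure.eq_infinitePi (fun _ : Label => markLaw) fun s A hA => ?_
  rw [Measure.map_apply hmeas (MeasurableSet.pi s.countable_toSet fun i _ => hA i)]
  have hpre : (fun p : Marks × (ℝ × I) => Function.update p.1 v p.2) ⁻¹' ((s : Set Label).pi A) =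
      (((s.erase v : Finset Label) : Set Label).pi A) ×ˢ (if v ∈ s then A v else Set.univ) := by
    ext ⟨ξ, m⟩
    simp only [Set.mem_preimage, Set.mem_pi, Finset.mem_coe, Set.mem_prod, Finset.mem_erase]
    constructor
    · intro h
      refine ⟨fun i hi => by simpa [Function.update_of_ne hi.1] using h i hi.2, ?_⟩
      split_ifs with hv
      · simpa using h v hv
      · trivial
    · rintro ⟨h1, h2⟩ i hi
      by_cases hiv : i = v
      · subst hiv
        simpa [hi] using h2
      · simpa [Function.update_of_ne hiv] using h1 i ⟨hiv, hi⟩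
  have hpi : marksLaw (((s.erase v : Finset Label) : Set Label).pi A) =
      ∏ i ∈ s.erase v, markLaw (A i) := Measure.infinitePi_pi _ fun i _ => hA i
  rw [hpre, Measure.prod_prod, hpi]
  split_ifs with hv
  · rw [mul_comm, Finset.mul_prod_erase s (fun i => markLaw (A i)) hv]
  · rw [measure_univ, mul_one, Finset.erase_eq_of_notMem hv]

lemma lintegral_marksLaw_update (v : Label) {F : Marks → ℝ≥0∞} (hF : Measurable F) :
    ∫⁻ ξ, F ξ ∂marksLaw = ∫⁻ ξ, ∫⁻ m, F (Function.update ξ v m) ∂markLaw ∂marksLaw := by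
  conv_lhs => rw [← map_update_marksLaw v]
  rw [lintegral_map hF measurable_update', lintegral_prod]
  exact (hF.comp measurable_update').aemeasurable

section

variable {κ Λ : ℝ} {μ : KillSite → ℝ} {x : ℤ}

variable (κ Λ μ) in
/-- The start of the successor with label bit `b` of a particle started at `p` with mark `m`. -/
def next (b : Bool) (p : ℤ × ℝ) (m : ℝ × I) : Option (ℤ × ℝ) :=
  match eventAt κ Λ μ p.1 m.2 with
  | Event.left => if b = false then some (p.1 - 1, p.2 + m.1 / totalRate κ Λ μ p.1) else none
  | Event.right => if b = false then some (p.1 + 1, p.2 + m.1 / totalRate κ Λ μ p.1) else none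
  | Event.react => if p.1 = 0 then some (0, p.2 + m.1 / totalRate κ Λ μ p.1) else none

lemma start_cons (b : Bool) (v : Label) (ξ : Marks) :
    start κ Λ μ x ξ (b :: v) = (start κ Λ μ x ξ v).bind fun p => next κ Λ μ b p (ξ v) := by
  rw [start]
  cases start κ Λ μ x ξ v <;> rfl

/-- The start of `v` depends only on the marks of its proper ancestors, whose labels are strictly
shorter. -/
lemma start_update {v w : Label} (h : v.length ≤ w.length) (ξ : Marks) (m : ℝ × I) :
    start κ Λ μ x (Function.update ξ w m) v = start κ Λ μ x ξ v := by
  induction v with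
  | nil => rfl
  | cons b v ih =>
    rw [List.length_cons] at h
    have hne : v ≠ w := by
      rintro rfl
      omega
    rw [start_cons, start_cons, ih (by omega), Function.update_of_ne hne]

/-- Sites are countable, so a fixed site suffices, where the value is a case distinction on the
uniform mark. The dependence of `G` on the parameter lets the induction in `measurable_elim_start`
absorb the parent's mark. -/
lemma measurable_elim_next {γ : Type*} [MeasurableSpace γ] (b : Bool) {m : γ → ℝ × I}
    (hm : Measurable m) {G : γ → ℤ × ℝ → ℝ≥0∞} (hG : Measurable (Function.uncurry G)) :
    Measurable fun q : γ × (ℤ × ℝ) => (next κ Λ μ b q.2 (m q.1)).elim 0 (G q.1) := by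
  have key : Measurable fun q : ℤ × (γ × ℝ) =>
      (next κ Λ μ b (q.1, q.2.2) (m q.2.1)).elim 0 (G q.2.1) := by
    refine measurable_from_prod_countable_right fun z => ?_
    have hu : Measurable fun q : γ × ℝ => ((m q.1).2 : ℝ) := by fun_prop
    have hGz : ∀ z' : ℤ, Measurable fun q : γ × ℝ =>
        G q.1 (z', q.2 + (m q.1).1 / totalRate κ Λ μ z) := fun z' =>
      hG.comp (by fun_prop : Measurable fun q : γ × ℝ =>
        (q.1, (z', q.2 + (m q.1).1 / totalRate κ Λ μ z)))
    have heq : (fun q : γ × ℝ => (next κ Λ μ b (z, q.2) (m q.1)).elim 0 (G q.1)) = fun q =>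
        if ((m q.1).2 : ℝ) < (κ / 2) / totalRate κ Λ μ z then
          if b = false then G q.1 (z - 1, q.2 + (m q.1).1 / totalRate κ Λ μ z) else 0
        else if ((m q.1).2 : ℝ) < κ / totalRate κ Λ μ z then
          if b = false then G q.1 (z + 1, q.2 + (m q.1).1 / totalRate κ Λ μ z) else 0
        else if z = 0 then G q.1 (0, q.2 + (m q.1).1 / totalRate κ Λ μ z) else 0 := by
      funext q
      unfold next eventAt
      split_ifs <;> simp_all
    simp only
    rw [heq]
    refine Measurable.ite (measurableSet_lt hu measurable_const) ?_
      (Measurable.ite (measurableSet_lt hu measurable_const) ?_ ?_)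
    all_goals split_ifs
    all_goals first | exact hGz _ | exact measurable_const
  exact key.comp (by fun_prop : Measurable fun q : γ × (ℤ × ℝ) => (q.2.1, (q.1, q.2.2)))

lemma measurable_elim_start {γ : Type*} [MeasurableSpace γ] (v : Label) {ξ : γ → Marks}
    (hξ : Measurable ξ) {G : γ → ℤ × ℝ → ℝ≥0∞} (hG : Measurable (Function.uncurry G)) :
    Measurable fun a => (start κ Λ μ x (ξ a) v).elim 0 (G a) := by
  induction v generalizing G with
  | nil => exact hG.comp (by fun_prop : Measurable fun a : γ => (a, ((x, 0) : ℤ × ℝ)))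
  | cons b v ih =>
    have h1 := ih (G := fun a p => (next κ Λ μ b p (ξ a v)).elim 0 (G a))
      (measurable_elim_next b ((measurable_pi_apply v).comp hξ) hG)
    convert! h1 using 2 with a
    rw [start_cons]
    cases start κ Λ μ x (ξ a) v <;> rfl

variable (κ Λ μ x) in
/-- The expectation of a function of the start of the particle `v`. -/
def startMean (v : Label) (G : ℤ × ℝ → ℝ≥0∞) : ℝ≥0∞ :=
  ∫⁻ ξ, (start κ Λ μ x ξ v).elim 0 G ∂marksLaw

/-- The mark of a particle is independent of its start. -/
lemma lintegral_elim_start (v : Label) {G : ℝ × I → ℤ × ℝ → ℝ≥0∞}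
    (hG : Measurable (Function.uncurry G)) :
    ∫⁻ ξ, (start κ Λ μ x ξ v).elim 0 (G (ξ v)) ∂marksLaw =
      startMean κ Λ μ x v fun p => ∫⁻ m, G m p ∂markLaw := by
  have hmeas : Measurable fun ξ : Marks => (start κ Λ μ x ξ v).elim 0 (G (ξ v)) :=
    measurable_elim_start v measurable_id (G := fun ξ => G (ξ v))
      (hG.comp (by fun_prop : Measurable fun q : Marks × (ℤ × ℝ) => (q.1 v, q.2)))
  -- Resampling the mark of `v` leaves its start unchanged.
  rw [lintegral_marksLaw_update v hmeas]
  refine lintegral_congr fun ξ => ?_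
  simp only [start_update le_rfl, Function.update_self]
  cases start κ Λ μ x ξ v
  · simp
  · rfl

lemma startMean_cons (b : Bool) (v : Label) {G : ℤ × ℝ → ℝ≥0∞} (hG : Measurable G) :
    startMean κ Λ μ x (b :: v) G = startMean κ Λ μ x v fun p =>
      ∫⁻ m, (next κ Λ μ b p m).elim 0 G ∂markLaw := by
  rw [← lintegral_elim_start v (G := fun m p => (next κ Λ μ b p m).elim 0 G)
    (measurable_elim_next b measurable_id (G := fun _ => G) (hG.comp measurable_snd))]
  refine lintegral_congr fun ξ => ?_
  rw [start_cons]
  cases start κ Λ μ x ξ v <;> rfl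

end

/-! ### Exponential waiting times and one-step transitions. -/

/-- The probability that a waiting time with rate `a` starting at `s` exceeds `t`. -/
def decay (a t s : ℝ) : ℝ≥0∞ := if s ≤ t then ENNReal.ofReal (Real.exp (-(a * (t - s)))) else 0

lemma measurable_decay (a : ℝ) : Measurable fun p : ℝ × ℝ => decay a p.1 p.2 :=
  Measurable.ite (measurableSet_le measurable_snd measurable_fst) (by fun_prop) measurable_const

/-- Substitute r = s + e/a: the end of the waiting period has density a exp(-a(r - s)) on r ≥ s. -/
lemma lintegral_expMeasure_comp {a : ℝ} (ha : 0 < a) (s : ℝ) {F : ℝ → ℝ≥0∞} (hF : Measurable F) :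
    ∫⁻ e, F (s + e / a) ∂expMeasure 1 = ENNReal.ofReal a * ∫⁻ r, decay a r s * F r := by
  have hpdf : Measurable (exponentialPDF 1) := (measurable_exponentialPDFReal 1).ennreal_ofReal
  have h1 : ∫⁻ e, F (s + e / a) ∂expMeasure 1 = ∫⁻ e, exponentialPDF 1 e * F (s + e / a) :=
    lintegral_withDensity_eq_lintegral_mul volume hpdf
      (hF.comp (by fun_prop : Measurable fun e : ℝ => s + e / a))
  have h2 : ∀ e, exponentialPDF 1 e * F (s + e / a) =
      (fun r => exponentialPDF 1 (a * r) * F (s + r)) (a⁻¹ * e) := by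
    intro e
    simp only
    rw [mul_inv_cancel_left₀ ha.ne', inv_mul_eq_div]
  have hk : Measurable fun r => exponentialPDF 1 (a * r) * F (s + r) := by fun_prop
  have h3 := congrArg (fun ν : Measure ℝ => ∫⁻ r, exponentialPDF 1 (a * r) * F (s + r) ∂ν)
    (Real.smul_map_volume_mul_left (inv_ne_zero ha.ne'))
  rw [lintegral_smul_measure, lintegral_map hk (by fun_prop), abs_of_pos (inv_pos.2 ha)] at h3
  have h4 : ∀ r, exponentialPDF 1 (a * r) * F (s + r) = (fun r => decay a r s * F r) (s + r) := by
    intro r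
    simp only [exponentialPDF_eq, decay, le_add_iff_nonneg_right, mul_nonneg_iff_of_pos_left ha,
      one_mul, add_sub_cancel_left]
    split_ifs <;> simp
  rw [h1]
  simp only [h2]
  calc _ = ENNReal.ofReal a * (ENNReal.ofReal a⁻¹ *
        ∫⁻ e, exponentialPDF 1 (a * (a⁻¹ * e)) * F (s + a⁻¹ * e)) := by
        rw [← mul_assoc, ← ENNReal.ofReal_mul ha.le, mul_inv_cancel₀ ha.ne', ENNReal.ofReal_one,
          one_mul]
    _ = ENNReal.ofReal a * ∫⁻ r, exponentialPDF 1 (a * r) * F (s + r) := by rw [← h3, smul_eq_mul]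
    _ = _ := by
      simp only [h4]
      rw [lintegral_add_left_eq_self (fun r => decay a r s * F r) s]

lemma expMeasure_Ioi {x : ℝ} (hx : 0 ≤ x) :
    expMeasure 1 (Set.Ioi x) = ENNReal.ofReal (Real.exp (-x)) := by
  have : IsProbabilityMeasure (expMeasure 1) := isProbabilityMeasure_expMeasure zero_lt_one
  rw [← Set.compl_Iic, prob_compl_eq_one_sub measurableSet_Iic, ← ofReal_cdf,
    cdf_expMeasure_eq zero_lt_one, if_pos hx, ← ENNReal.ofReal_one,
    ← ENNReal.ofReal_sub _ (by simpa using hx)]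
  simp

section

variable {κ Λ : ℝ} {μ : KillSite → ℝ} {x : ℤ}

lemma totalRate_pos (hκ : 0 < κ) (hΛ : 0 ≤ Λ) (hμ : ∀ z, 0 ≤ μ z) (z : ℤ) :
    0 < totalRate κ Λ μ z := by
  unfold totalRate
  split_ifs with h
  · positivity
  · have := hμ ⟨z, h⟩
    positivity

lemma le_totalRate (hΛ : 0 ≤ Λ) (hμ : ∀ z, 0 ≤ μ z) (z : ℤ) : κ ≤ totalRate κ Λ μ z := by
  unfold totalRate
  split_ifs with h
  · linarith
  · linarith [hμ ⟨z, h⟩]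

lemma lintegral_eventAt (hκ : 0 < κ) (hΛ : 0 ≤ Λ) (hμ : ∀ z, 0 ≤ μ z) (z : ℤ) (h : Event → ℝ≥0∞) :
    ∫⁻ u : I, h (eventAt κ Λ μ z u) =
      ENNReal.ofReal ((κ / 2) / totalRate κ Λ μ z) * h Event.left +
      ENNReal.ofReal ((κ / 2) / totalRate κ Λ μ z) * h Event.right +
      ENNReal.ofReal (1 - κ / totalRate κ Λ μ z) * h Event.react := by
  have ha := totalRate_pos hκ hΛ hμ z
  have hle := le_totalRate (κ := κ) hΛ hμ z
  have hp2 : κ / totalRate κ Λ μ z ≤ 1 := (div_le_one ha).2 hle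
  have hp12 : (κ / 2) / totalRate κ Λ μ z ≤ κ / totalRate κ Λ μ z := by gcongr; linarith
  let p : I := ⟨(κ / 2) / totalRate κ Λ μ z, by positivity, hp12.trans hp2⟩
  let q : I := ⟨κ / totalRate κ Λ μ z, by positivity, hp2⟩
  have heq : ∀ u : I, h (eventAt κ Λ μ z u) = (Set.Iio p).indicator (fun _ => h Event.left) u +
      (Set.Ico p q).indicator (fun _ => h Event.right) u +
      (Set.Ici q).indicator (fun _ => h Event.react) u := by
    intro u
    have e1 : (u : ℝ) < (κ / 2) / totalRate κ Λ μ z ↔ u < p := Iff.rfl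
    have e2 : (u : ℝ) < κ / totalRate κ Λ μ z ↔ u < q := Iff.rfl
    have hpq : p ≤ q := hp12
    simp only [eventAt, e1, e2, Set.indicator, Set.mem_Iio, Set.mem_Ico, Set.mem_Ici]
    rcases lt_or_ge u p with h1 | h1
    · simp [h1, not_le.2 h1, not_le.2 (h1.trans_le hpq)]
    · rcases lt_or_ge u q with h2 | h2
      · simp [h1, h2, not_lt.2 h1, not_le.2 h2]
      · simp [h2, not_lt.2 h1, not_lt.2 h2]
  simp only [heq]
  rw [lintegral_add_right _ (measurable_const.indicator measurableSet_Ici),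
    lintegral_add_right _ (measurable_const.indicator measurableSet_Ico),
    lintegral_indicator_const measurableSet_Iio, lintegral_indicator_const measurableSet_Ico,
    lintegral_indicator_const measurableSet_Ici, unitInterval.volume_Iio, unitInterval.volume_Ico,
    unitInterval.volume_Ici, mul_comm (h _), mul_comm (h _), mul_comm (h _)]
  have hsub : (q : ℝ) - p = (κ / 2) / totalRate κ Λ μ z := by
    change κ / totalRate κ Λ μ z - (κ / 2) / totalRate κ Λ μ z = _
    ring
  rw [hsub]

variable (κ Λ μ) in
/-- The conditional probability that a particle started at `p` is at `y` at time `t`. -/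
def survival (t : ℝ) (y : ℤ) (p : ℤ × ℝ) : ℝ≥0∞ :=
  if p.1 = y then decay (totalRate κ Λ μ y) t p.2 else 0

lemma measurable_survival (y : ℤ) :
    Measurable fun q : ℝ × (ℤ × ℝ) => survival κ Λ μ q.1 y q.2 :=
  Measurable.ite (measurableSet_eq_fun (by fun_prop) (by fun_prop))
    ((measurable_decay _).comp (by fun_prop : Measurable fun q : ℝ × (ℤ × ℝ) => (q.1, q.2.2)))
    measurable_const

lemma measurable_survival_right (t : ℝ) (y : ℤ) : Measurable (survival κ Λ μ t y) :=
  (measurable_survival y).comp measurable_prodMk_left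

variable (κ Λ μ) in
open Classical in
/-- The indicator of a particle started at `p` with mark `m` being at `y` at time `t`. -/
def presentIndicator (t : ℝ) (y : ℤ) (m : ℝ × I) (p : ℤ × ℝ) : ℝ≥0∞ :=
  if p.1 = y ∧ p.2 ≤ t ∧ t < p.2 + m.1 / totalRate κ Λ μ y then 1 else 0

lemma measurable_presentIndicator (t : ℝ) (y : ℤ) :
    Measurable (Function.uncurry (presentIndicator κ Λ μ t y)) := by
  have h1 : MeasurableSet {q : (ℝ × I) × (ℤ × ℝ) | q.2.1 = y} :=
    measurableSet_eq_fun (by fun_prop) (by fun_prop)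
  have h2 : MeasurableSet {q : (ℝ × I) × (ℤ × ℝ) | q.2.2 ≤ t} :=
    measurableSet_le (by fun_prop) (by fun_prop)
  have h3 : MeasurableSet {q : (ℝ × I) × (ℤ × ℝ) | t < q.2.2 + q.1.1 / totalRate κ Λ μ y} :=
    measurableSet_lt (by fun_prop) (by fun_prop)
  exact Measurable.ite (h1.inter (h2.inter h3)) measurable_const measurable_const

lemma lintegral_presentIndicator (hκ : 0 < κ) (hΛ : 0 ≤ Λ) (hμ : ∀ z, 0 ≤ μ z) (t : ℝ) (y : ℤ)
    (p : ℤ × ℝ) :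
    ∫⁻ m, presentIndicator κ Λ μ t y m p ∂markLaw = survival κ Λ μ t y p := by
  have ha := totalRate_pos hκ hΛ hμ y
  unfold presentIndicator survival decay
  by_cases h : p.1 = y ∧ p.2 ≤ t
  · have heq : ∀ m : ℝ × I, (if p.1 = y ∧ p.2 ≤ t ∧ t < p.2 + m.1 / totalRate κ Λ μ y then 1
        else 0 : ℝ≥0∞) =
        (Set.Ioi (totalRate κ Λ μ y * (t - p.2)) ×ˢ (Set.univ : Set I)).indicator 1 m := by
      intro m
      have : (p.1 = y ∧ p.2 ≤ t ∧ t < p.2 + m.1 / totalRate κ Λ μ y) ↔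
          m ∈ Set.Ioi (totalRate κ Λ μ y * (t - p.2)) ×ˢ (Set.univ : Set I) := by
        simp only [h.1, h.2, true_and, Set.mem_prod, Set.mem_Ioi, Set.mem_univ, and_true]
        rw [← sub_lt_iff_lt_add', lt_div_iff₀ ha, mul_comm]
      rw [Set.indicator_apply]
      simp only [this, Pi.one_apply]
    simp only [heq]
    rw [lintegral_indicator_one (measurableSet_Ioi.prod MeasurableSet.univ), if_pos h.1, if_pos h.2]
    unfold markLaw
    have : IsProbabilityMeasure (expMeasure 1) := isProbabilityMeasure_expMeasure zero_lt_one
    rw [Measure.prod_prod, measure_univ, mul_one,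
      expMeasure_Ioi (mul_nonneg ha.le (sub_nonneg.2 h.2))]
  · have heq : ∀ m : ℝ × I, ¬ (p.1 = y ∧ p.2 ≤ t ∧ t < p.2 + m.1 / totalRate κ Λ μ y) :=
      fun m hm => h ⟨hm.1, hm.2.1⟩
    simp only [heq, if_false, lintegral_zero]
    split_ifs with h1 h2
    · exact absurd ⟨h1, h2⟩ h
    · rfl
    · rfl

lemma ite_presentAt (ξ : Marks) (v : Label) (t : ℝ) (y : ℤ)
    [Decidable (PresentAt κ Λ μ x ξ v t y)] :
    (if PresentAt κ Λ μ x ξ v t y then 1 else 0 : ℝ≥0∞) =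
      (start κ Λ μ x ξ v).elim 0 (presentIndicator κ Λ μ t y (ξ v)) := by
  classical
  have hiff : PresentAt κ Λ μ x ξ v t y ↔ ∃ p, start κ Λ μ x ξ v = some p ∧
      p.1 = y ∧ p.2 ≤ t ∧ t < p.2 + (ξ v).1 / totalRate κ Λ μ y := by
    constructor
    · rintro ⟨s, h1, h2⟩
      exact ⟨(y, s), h1, rfl, h2⟩
    · rintro ⟨⟨_, s⟩, h1, rfl, h2⟩
      exact ⟨s, h1, h2⟩
  rw [if_congr hiff rfl rfl]
  generalize start κ Λ μ x ξ v = o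
  rcases o with _ | p
  · simp
  · simp [presentIndicator]

variable (κ Λ μ x) in
/-- The probability that the particle `v` is at `y` at time `t`. -/
def presence (v : Label) (t : ℝ) (y : ℤ) : ℝ≥0∞ := startMean κ Λ μ x v (survival κ Λ μ t y)

theorem meanNumber_eq_tsum (hκ : 0 < κ) (hΛ : 0 ≤ Λ) (hμ : ∀ z, 0 ≤ μ z) (t : ℝ) (y : ℤ) :
    meanNumber κ Λ μ t x y = ∑' v, presence κ Λ μ x v t y := by
  unfold meanNumber particleNumber
  simp only [ite_presentAt]
  rw [lintegral_tsum]
  · refine tsum_congr fun v => ?_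
    rw [lintegral_elim_start v (measurable_presentIndicator t y)]
    unfold presence
    congr 1
    funext p
    exact lintegral_presentIndicator hκ hΛ hμ t y p
  · intro v
    exact (measurable_elim_start v measurable_id (G := fun ξ => presentIndicator κ Λ μ t y (ξ v))
      ((measurable_presentIndicator t y).comp
        (by fun_prop : Measurable fun q : Marks × (ℤ × ℝ) => (q.1 v, q.2)))).aemeasurable

lemma measurable_presence (v : Label) (y : ℤ) :
    Measurable fun t => presence κ Λ μ x v t y := by
  have h : Measurable fun q : ℝ × Marks =>
      (start κ Λ μ x q.2 v).elim 0 (survival κ Λ μ q.1 y) :=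
    measurable_elim_start v measurable_snd (G := fun q : ℝ × Marks => survival κ Λ μ q.1 y)
      ((measurable_survival y).comp
        (by fun_prop : Measurable fun q : (ℝ × Marks) × (ℤ × ℝ) => (q.1.1, q.2)))
  exact h.lintegral_prod_right'

variable (κ Λ) in
/-- The rate of arrivals at `y`, by successors with label bit `b`, from a configuration `f`. -/
def inflow (b : Bool) (f : ℤ → ℝ≥0∞) (y : ℤ) : ℝ≥0∞ :=
  (if b = false then ENNReal.ofReal (κ / 2) * (f (y - 1) + f (y + 1)) else 0) +
    if y = 0 then ENNReal.ofReal Λ * f 0 else 0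

lemma lintegral_inflow {γ : Type*} [MeasurableSpace γ] {ν : Measure γ} (b : Bool)
    {f : γ → ℤ → ℝ≥0∞} (hf : ∀ z, Measurable fun a => f a z) (y : ℤ) :
    ∫⁻ a, inflow κ Λ b (f a) y ∂ν = inflow κ Λ b (fun z => ∫⁻ a, f a z ∂ν) y := by
  unfold inflow
  have h1 : Measurable fun a => if y = 0 then ENNReal.ofReal Λ * f a 0 else 0 := by
    split_ifs
    · exact (hf 0).const_mul _
    · exact measurable_const
  rw [lintegral_add_right _ h1]
  congr 1
  · split_ifs
    · rw [lintegral_const_mul _ (show Measurable fun a => f a (y - 1) + f a (y + 1) from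
        (hf _).add (hf _)), lintegral_add_left (hf _)]
    · simp
  · split_ifs
    · rw [lintegral_const_mul _ (hf _)]
    · simp

lemma measurable_inflow {γ : Type*} [MeasurableSpace γ] (b : Bool)
    {f : γ → ℤ → ℝ≥0∞} (hf : ∀ z, Measurable fun a => f a z) (y : ℤ) :
    Measurable fun a => inflow κ Λ b (f a) y := by
  unfold inflow
  refine Measurable.add ?_ ?_
  · split_ifs
    · exact ((hf _).add (hf _)).const_mul _
    · exact measurable_const
  · split_ifs
    · exact (hf 0).const_mul _
    · exact measurable_const

lemma inflow_const_mul (b : Bool) (a : ℝ≥0∞) (f : ℤ → ℝ≥0∞) (y : ℤ) :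
    inflow κ Λ b (fun z => a * f z) y = a * inflow κ Λ b f y := by
  unfold inflow
  split_ifs <;> ring

lemma inflow_zero (b : Bool) (y : ℤ) : inflow κ Λ b (fun _ => 0) y = 0 := by
  simp [inflow]

lemma inflow_tsum {ι : Type*} (b : Bool) (f : ι → ℤ → ℝ≥0∞) (y : ℤ) :
    inflow κ Λ b (fun z => ∑' i, f i z) y = ∑' i, inflow κ Λ b (f i) y := by
  unfold inflow
  rw [ENNReal.tsum_add]
  split_ifs <;> simp [ENNReal.tsum_mul_left, ENNReal.tsum_add]

/-- The one-step transition of the survival probabilities. -/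
lemma lintegral_elim_next (hκ : 0 < κ) (hΛ : 0 ≤ Λ) (hμ : ∀ z, 0 ≤ μ z) (b : Bool) (t : ℝ) (y : ℤ)
    (p : ℤ × ℝ) :
    ∫⁻ m, (next κ Λ μ b p m).elim 0 (survival κ Λ μ t y) ∂markLaw =
      ∫⁻ r, decay (totalRate κ Λ μ y) t r * inflow κ Λ b (fun z => survival κ Λ μ r z p) y := by
  obtain ⟨z, s⟩ := p
  have ha := totalRate_pos hκ hΛ hμ z
  set a := totalRate κ Λ μ z with hadef
  set J : ℝ≥0∞ := ∫⁻ r, decay (totalRate κ Λ μ y) t r * decay a r s with hJ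
  have hmeas : Measurable fun m => (next κ Λ μ b (z, s) m).elim 0 (survival κ Λ μ t y) :=
    (measurable_elim_next b measurable_id (G := fun _ => survival κ Λ μ t y)
      ((measurable_survival_right t y).comp measurable_snd)).comp
      (by fun_prop : Measurable fun m : ℝ × I => (m, ((z, s) : ℤ × ℝ)))
  have hdecay : Measurable (decay (totalRate κ Λ μ y) t) :=
    (measurable_decay _).comp measurable_prodMk_left
  have hstep : ∀ z' : ℤ, ∫⁻ e, survival κ Λ μ t y (z', s + e / a) ∂expMeasure 1 =
      if z' = y then ENNReal.ofReal a * J else 0 := by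
    intro z'
    unfold survival
    split_ifs with h
    · rw [lintegral_expMeasure_comp ha s hdecay]
      simp only [hJ, mul_comm (decay a _ _)]
    · simp
  have hstepm : ∀ z' : ℤ, Measurable fun e => survival κ Λ μ t y (z', s + e / a) := fun z' =>
    (measurable_survival_right t y).comp (by fun_prop)
  have hleft : ∫⁻ m, (next κ Λ μ b (z, s) m).elim 0 (survival κ Λ μ t y) ∂markLaw =
      ENNReal.ofReal ((κ / 2) / a) *
        (if b = false then (if z - 1 = y then ENNReal.ofReal a * J else 0) else 0) +
      ENNReal.ofReal ((κ / 2) / a) *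
        (if b = false then (if z + 1 = y then ENNReal.ofReal a * J else 0) else 0) +
      ENNReal.ofReal (1 - κ / a) *
        (if z = 0 then (if 0 = y then ENNReal.ofReal a * J else 0) else 0) := by
    unfold markLaw
    rw [lintegral_prod _ hmeas.aemeasurable]
    have h1 : ∀ e : ℝ, ∫⁻ u : I, (next κ Λ μ b (z, s) (e, u)).elim 0 (survival κ Λ μ t y) =
        ENNReal.ofReal ((κ / 2) / a) *
          (if b = false then survival κ Λ μ t y (z - 1, s + e / a) else 0) +
        ENNReal.ofReal ((κ / 2) / a) *
          (if b = false then survival κ Λ μ t y (z + 1, s + e / a) else 0) +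
        ENNReal.ofReal (1 - κ / a) *
          (if z = 0 then survival κ Λ μ t y (0, s + e / a) else 0) := by
      intro e
      rw [hadef, ← lintegral_eventAt hκ hΛ hμ z fun ev => match ev with
        | Event.left => if b = false then survival κ Λ μ t y (z - 1, s + e / a) else 0
        | Event.right => if b = false then survival κ Λ μ t y (z + 1, s + e / a) else 0
        | Event.react => if z = 0 then survival κ Λ μ t y (0, s + e / a) else 0]
      refine lintegral_congr fun u => ?_
      unfold next
      simp only
      cases eventAt κ Λ μ z u <;> simp only <;> split_ifs <;> rfl
    have hm : ∀ (P : Prop) [Decidable P] (c : ℝ≥0∞) (z' : ℤ),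
        Measurable fun e => c * if P then survival κ Λ μ t y (z', s + e / a) else 0 := by
      intro P _ c z'
      split_ifs
      · exact (hstepm z').const_mul c
      · exact measurable_const.const_mul c
    have hi : ∀ (P : Prop) [Decidable P] (c : ℝ≥0∞) (z' : ℤ),
        ∫⁻ e, c * (if P then survival κ Λ μ t y (z', s + e / a) else 0) ∂expMeasure 1 =
          c * if P then (if z' = y then ENNReal.ofReal a * J else 0) else 0 := by
      intro P _ c z'
      split_ifs with h1 h2
      · rw [lintegral_const_mul _ (hstepm z'), hstep, if_pos h2]
      · rw [lintegral_const_mul _ (hstepm z'), hstep, if_neg h2]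
      · simp
    simp only [h1]
    rw [lintegral_add_right _ (hm _ _ _), lintegral_add_right _ (hm _ _ _), hi, hi, hi]
  have hright : ∫⁻ r, decay (totalRate κ Λ μ y) t r *
      inflow κ Λ b (fun z' => survival κ Λ μ r z' (z, s)) y =
      inflow κ Λ b (fun z' => if z = z' then J else 0) y := by
    simp only [← inflow_const_mul]
    rw [lintegral_inflow]
    · congr 1
      funext z'
      unfold survival
      by_cases h : z = z'
      · subst h
        simp only [if_true, hJ, hadef]
      · simp [h]
    · intro z'
      exact hdecay.mul ((measurable_survival z').comp
        (by fun_prop : Measurable fun r : ℝ => (r, ((z, s) : ℤ × ℝ))))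
  -- The factor a of the waiting time density cancels the denominator of the event probabilities,
  -- leaving the rates κ/2 and Λ.
  have hmul : ∀ c : ℝ, ENNReal.ofReal (c / a) * (ENNReal.ofReal a * J) = ENNReal.ofReal c * J := by
    intro c
    rw [← mul_assoc, ← ENNReal.ofReal_mul' ha.le, div_mul_cancel₀ _ ha.ne']
  have hreact : z = 0 → ENNReal.ofReal (1 - κ / a) * (ENNReal.ofReal a * J) =
      ENNReal.ofReal Λ * J := by
    intro hz
    have : 1 - κ / a = Λ / a := by
      rw [eq_div_iff ha.ne', sub_mul, one_mul, div_mul_cancel₀ _ ha.ne', hadef, totalRate,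
        dif_pos hz]
      ring
    rw [this, hmul]
  have hthird : ENNReal.ofReal (1 - κ / a) *
      (if z = 0 then (if 0 = y then ENNReal.ofReal a * J else 0) else 0) =
      if y = 0 then ENNReal.ofReal Λ * (if z = 0 then J else 0) else 0 := by
    by_cases hz : z = 0
    · by_cases hy : y = 0
      · simp only [hz, hy, if_true, hreact hz]
      · simp [hy, Ne.symm hy]
    · simp [hz]
  have e1 : z - 1 = y ↔ z = y + 1 := by omega
  have e2 : z + 1 = y ↔ z = y - 1 := by omega
  rw [hleft, hright, hthird]
  unfold inflow
  simp only [e1, e2]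
  congr 1
  cases b
  · simp only [if_true, mul_ite, mul_zero, hmul, mul_add]
    rw [add_comm]
  · simp

end

/-! ### The recursion over generations. -/

section

variable {κ Λ : ℝ} {μ : KillSite → ℝ} {x : ℤ}

/-- Integrate out the mark of `v`, independent of its start, by `lintegral_elim_next`; then exchange
integrals by Tonelli. -/
theorem presence_cons (hκ : 0 < κ) (hΛ : 0 ≤ Λ) (hμ : ∀ z, 0 ≤ μ z) (b : Bool) (v : Label)
    (t : ℝ) (y : ℤ) : presence κ Λ μ x (b :: v) t y =
      ∫⁻ r, decay (totalRate κ Λ μ y) t r *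
        inflow κ Λ b (fun z => presence κ Λ μ x v r z) y := by
  have hmeas : ∀ z, Measurable fun q : Marks × ℝ =>
      (start κ Λ μ x q.1 v).elim 0 (survival κ Λ μ q.2 z) := fun z =>
    measurable_elim_start v measurable_fst (G := fun q : Marks × ℝ => survival κ Λ μ q.2 z)
      ((measurable_survival z).comp
        (by fun_prop : Measurable fun q : (Marks × ℝ) × (ℤ × ℝ) => (q.1.2, q.2)))
  have hdecay : Measurable (decay (totalRate κ Λ μ y) t) :=
    (measurable_decay _).comp measurable_prodMk_left
  unfold presence
  rw [startMean_cons b v (measurable_survival_right t y)]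
  simp only [lintegral_elim_next hκ hΛ hμ]
  unfold startMean
  have h1 : ∀ ξ : Marks, (start κ Λ μ x ξ v).elim 0 (fun p => ∫⁻ r, decay (totalRate κ Λ μ y) t r *
      inflow κ Λ b (fun z => survival κ Λ μ r z p) y) = ∫⁻ r, decay (totalRate κ Λ μ y) t r *
      inflow κ Λ b (fun z => (start κ Λ μ x ξ v).elim 0 (survival κ Λ μ r z)) y := by
    intro ξ
    cases start κ Λ μ x ξ v
    · simp [inflow_zero]
    · rfl
  simp only [h1]
  rw [lintegral_lintegral_swap]
  · refine lintegral_congr fun r => ?_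
    have h2 : ∀ z, Measurable fun ξ : Marks =>
        (start κ Λ μ x ξ v).elim 0 (survival κ Λ μ r z) := fun z =>
      (hmeas z).comp (by fun_prop : Measurable fun ξ : Marks => (ξ, r))
    rw [lintegral_const_mul _ (measurable_inflow b h2 y), lintegral_inflow b h2]
  · exact ((hdecay.comp measurable_snd).mul (measurable_inflow b hmeas y)).aemeasurable

variable (κ Λ μ) in
/-- The contribution of one more generation. -/
def generationStep (f : ℝ → ℤ → ℝ≥0∞) (t : ℝ) (y : ℤ) : ℝ≥0∞ :=
  ∫⁻ r, decay (totalRate κ Λ μ y) t r * (inflow κ Λ false (f r) y + inflow κ Λ true (f r) y)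

lemma measurable_totalInflow {γ : Type*} [MeasurableSpace γ] {f : γ → ℤ → ℝ≥0∞}
    (hf : ∀ z, Measurable fun a => f a z) (y : ℤ) :
    Measurable fun a => inflow κ Λ false (f a) y + inflow κ Λ true (f a) y :=
  (measurable_inflow false hf y).add (measurable_inflow true hf y)

lemma measurable_decay_right (a t : ℝ) : Measurable (decay a t) :=
  (measurable_decay a).comp measurable_prodMk_left

lemma measurable_decay_mul_inflow {f : ℝ → ℤ → ℝ≥0∞} (hf : ∀ z, Measurable fun r => f r z)
    (a t : ℝ) (y : ℤ) : Measurable fun r =>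
      decay a t r * (inflow κ Λ false (f r) y + inflow κ Λ true (f r) y) :=
  (measurable_decay_right a t).mul (measurable_totalInflow hf y)

lemma measurable_generationStep {f : ℝ → ℤ → ℝ≥0∞} (hf : ∀ z, Measurable fun r => f r z) (y : ℤ) :
    Measurable fun t => generationStep κ Λ μ f t y := by
  have h : Measurable fun q : ℝ × ℝ => decay (totalRate κ Λ μ y) q.1 q.2 *
      (inflow κ Λ false (f q.2) y + inflow κ Λ true (f q.2) y) :=
    (measurable_decay _).mul ((measurable_totalInflow hf y).comp measurable_snd)
  exact h.lintegral_prod_right'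

lemma generationStep_add {f g : ℝ → ℤ → ℝ≥0∞} (hf : ∀ z, Measurable fun r => f r z)
    (t : ℝ) (y : ℤ) : generationStep κ Λ μ (fun r z => f r z + g r z) t y =
      generationStep κ Λ μ f t y + generationStep κ Λ μ g t y := by
  unfold generationStep
  rw [← lintegral_add_left (measurable_decay_mul_inflow hf _ t y)]
  refine lintegral_congr fun r => ?_
  unfold inflow
  split_ifs <;> ring

lemma generationStep_tsum {ι : Type*} [Countable ι] {f : ι → ℝ → ℤ → ℝ≥0∞}
    (hf : ∀ i z, Measurable fun r => f i r z) (t : ℝ) (y : ℤ) :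
    generationStep κ Λ μ (fun r z => ∑' i, f i r z) t y = ∑' i, generationStep κ Λ μ (f i) t y := by
  unfold generationStep
  rw [← lintegral_tsum fun i =>
    (measurable_decay_mul_inflow (hf i) _ t y).aemeasurable]
  refine lintegral_congr fun r => ?_
  rw [inflow_tsum, inflow_tsum, ← ENNReal.tsum_add, ENNReal.tsum_mul_left]

variable (κ Λ μ x) in
/-- The mean number of particles of generation `n` at `y` at time `t`. -/
def generation (n : ℕ) (t : ℝ) (y : ℤ) : ℝ≥0∞ :=
  ∑' v : Label, if v.length = n then presence κ Λ μ x v t y else 0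

lemma measurable_ite_presence (n : ℕ) (v : Label) (y : ℤ) :
    Measurable fun t => if v.length = n then presence κ Λ μ x v t y else 0 := by
  split_ifs
  · exact measurable_presence v y
  · exact measurable_const

lemma measurable_generation (n : ℕ) (y : ℤ) : Measurable fun t => generation κ Λ μ x n t y :=
  Measurable.tsum fun v => measurable_ite_presence n v y

lemma generation_zero (t : ℝ) (y : ℤ) :
    generation κ Λ μ x 0 t y = if x = y then decay (totalRate κ Λ μ y) t 0 else 0 := by
  unfold generation
  rw [tsum_eq_single ([] : Label)]
  · simp [presence, startMean, start, survival]
  · intro v hv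
    rw [if_neg (by simpa using hv)]

lemma tsum_label_eq {f : Label → ℝ≥0∞} (h : f [] = 0) :
    ∑' v, f v = ∑' v : Label, (f (false :: v) + f (true :: v)) := by
  have hinj : Function.Injective fun p : Bool × Label => p.1 :: p.2 := by
    rintro ⟨b, v⟩ ⟨b', v'⟩ h
    simpa using h
  rw [← hinj.tsum_eq, ENNReal.tsum_prod (f := fun b v => f (b :: v)), tsum_bool, ENNReal.tsum_add]
  intro v hv
  cases v with
  | nil => exact absurd h hv
  | cons b v => exact ⟨(b, v), rfl⟩

lemma generation_succ (hκ : 0 < κ) (hΛ : 0 ≤ Λ) (hμ : ∀ z, 0 ≤ μ z) (n : ℕ) (t : ℝ) (y : ℤ) :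
    generation κ Λ μ x (n + 1) t y = generationStep κ Λ μ (generation κ Λ μ x n) t y := by
  change _ = generationStep κ Λ μ (fun r z => ∑' v : Label,
    if v.length = n then presence κ Λ μ x v r z else 0) t y
  rw [generationStep_tsum (f := fun (v : Label) r z =>
      if v.length = n then presence κ Λ μ x v r z else 0)
    (fun v z => measurable_ite_presence n v z)]
  unfold generation
  rw [tsum_label_eq (by simp)]
  refine tsum_congr fun v => ?_
  unfold generationStep
  by_cases h : v.length = n
  · simp only [List.length_cons, h, if_true]
    have hm : Measurable fun r => decay (totalRate κ Λ μ y) t r *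
        inflow κ Λ false (fun z => presence κ Λ μ x v r z) y :=
      (measurable_decay_right _ _).mul
        (measurable_inflow false (fun z => measurable_presence v z) y)
    rw [presence_cons hκ hΛ hμ, presence_cons hκ hΛ hμ, ← lintegral_add_left hm]
    refine lintegral_congr fun r => ?_
    rw [mul_add]
  · simp [h, inflow_zero]

lemma tsum_generation (t : ℝ) (y : ℤ) :
    ∑' n, generation κ Λ μ x n t y = ∑' v, presence κ Λ μ x v t y := by
  unfold generation
  rw [ENNReal.tsum_comm]
  refine tsum_congr fun v => ?_
  rw [tsum_eq_single v.length]
  · simp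
  · intro n hn
    rw [if_neg hn.symm]

end

/-! ### Identification of the mean numbers with the semigroup. -/

open LatticeL2 NormedSpace

/-- The potential of the mean number evolution: `Λ` at the source and `-μ` elsewhere. -/
def potential (Λ : ℝ) (μ : KillSite → ℝ) (z : ℤ) : ℝ := if h : z = 0 then Λ else -μ ⟨z, h⟩

section

variable {κ Λ D : ℝ} {μ : KillSite → ℝ} {x : ℤ} (hD : ∀ z, |potential Λ μ z| ≤ D)

variable (κ x) in
/-- The coordinate at `y` of the semigroup started from the unit vector at `x`. -/
def heatKernel (t : ℝ) (y : ℤ) : ℝ := exp (t • schrodinger κ (potential Λ μ) hD) (unit x) y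

variable (κ Λ x) in
/-- The real rate of arrivals at `y` from a configuration `f`. -/
def arrivalRate (f : ℤ → ℝ) (y : ℤ) : ℝ :=
  κ / 2 * (f (y - 1) + f (y + 1)) + if y = 0 then 2 * Λ * f 0 else 0

lemma heatKernel_nonneg (hκ : 0 ≤ κ) {t : ℝ} (ht : 0 ≤ t) (y : ℤ) : 0 ≤ heatKernel κ x hD t y :=
  exp_smul_schrodinger_nonneg hD hκ ht (fun z => by rw [unit_apply]; split_ifs <;> norm_num) y

lemma heatKernel_zero (y : ℤ) : heatKernel κ x hD 0 y = if y = x then 1 else 0 := by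
  unfold heatKernel
  rw [zero_smul, exp_zero, one_clm_apply, unit_apply]

/-- At the source two offspring arrive at rate 2Λ in total while departures have rate κ + Λ; the net
potential is Λ. -/
lemma schrodinger_potential_apply (f : LatticeL2) (y : ℤ) :
    schrodinger κ (potential Λ μ) hD f y =
      arrivalRate κ Λ f y - totalRate κ Λ μ y * f y := by
  rw [schrodinger_apply, arrivalRate, totalRate, potential]
  split_ifs with h
  · subst h; ring
  · ring

lemma hasDerivAt_heatKernel (t : ℝ) (y : ℤ) : HasDerivAt (fun s => heatKernel κ x hD s y)
    (arrivalRate κ Λ (heatKernel κ x hD t) y - totalRate κ Λ μ y * heatKernel κ x hD t y) t := by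
  have h := (lp.evalCLM ℝ (fun _ : ℤ => ℝ) 2 y).hasFDerivAt.comp_hasDerivAt t
    (ContinuousLinearMap.hasDerivAt_exp_smul_apply (schrodinger κ (potential Λ μ) hD) (unit x) t)
  exact h.congr_deriv (schrodinger_potential_apply hD _ y)

lemma continuous_heatKernel (y : ℤ) : Continuous fun t => heatKernel κ x hD t y :=
  continuous_iff_continuousAt.2 fun t => (hasDerivAt_heatKernel hD t y).continuousAt

lemma continuous_arrivalRate (y : ℤ) :
    Continuous fun t => arrivalRate κ Λ (heatKernel κ x hD t) y := by
  have h := continuous_heatKernel (κ := κ) (x := x) hD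
  unfold arrivalRate
  split_ifs
  · exact (continuous_const.mul ((h _).add (h _))).add (continuous_const.mul (h 0))
  · exact (continuous_const.mul ((h _).add (h _))).add continuous_const

/-- Duhamel's formula, with departures as the integrating factor and arrivals as the source term. -/
lemma heatKernel_eq_integral (t : ℝ) (y : ℤ) : heatKernel κ x hD t y =
    Real.exp (-(totalRate κ Λ μ y * t)) * (if y = x then 1 else 0) +
      ∫ r in (0 : ℝ)..t, Real.exp (-(totalRate κ Λ μ y * (t - r))) *
        arrivalRate κ Λ (heatKernel κ x hD r) y := by
  set a := totalRate κ Λ μ y with ha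
  have hd : ∀ r, HasDerivAt (fun r => Real.exp (-(a * (t - r))) * heatKernel κ x hD r y)
      (Real.exp (-(a * (t - r))) * arrivalRate κ Λ (heatKernel κ x hD r) y) r := by
    intro r
    have h1 : HasDerivAt (fun r => -(a * (t - r))) a r := by
      have := ((hasDerivAt_id r).const_sub t).const_mul (-a)
      simpa [neg_mul] using this
    refine (h1.exp.mul (hasDerivAt_heatKernel hD r y)).congr_deriv ?_
    rw [← ha]
    ring
  have hc : Continuous fun r => Real.exp (-(a * (t - r))) *
      arrivalRate κ Λ (heatKernel κ x hD r) y :=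
    (by fun_prop : Continuous fun r => Real.exp (-(a * (t - r)))).mul (continuous_arrivalRate hD y)
  rw [intervalIntegral.integral_eq_sub_of_hasDerivAt (fun r _ => hd r)
    (hc.intervalIntegrable _ _), heatKernel_zero]
  simp

variable (κ x) in
/-- The semigroup coordinates as extended nonnegative functions, extended by zero to negative
times. -/
def meanKernel (t : ℝ) (y : ℤ) : ℝ≥0∞ :=
  if 0 ≤ t then ENNReal.ofReal (heatKernel κ x hD t y) else 0

lemma measurable_meanKernel (y : ℤ) : Measurable fun t => meanKernel κ x hD t y :=
  Measurable.ite measurableSet_Ici (continuous_heatKernel hD y).measurable.ennreal_ofReal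
    measurable_const

lemma inflow_meanKernel (hκ : 0 ≤ κ) (hΛ : 0 ≤ Λ) {t : ℝ} (ht : 0 ≤ t) (y : ℤ) :
    inflow κ Λ false (meanKernel κ x hD t) y + inflow κ Λ true (meanKernel κ x hD t) y =
      ENNReal.ofReal (arrivalRate κ Λ (heatKernel κ x hD t) y) := by
  have h := heatKernel_nonneg (x := x) hD hκ ht
  have hadd : ENNReal.ofReal (κ / 2) * (ENNReal.ofReal (heatKernel κ x hD t (y - 1)) +
      ENNReal.ofReal (heatKernel κ x hD t (y + 1))) = ENNReal.ofReal (κ / 2 *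
        (heatKernel κ x hD t (y - 1) + heatKernel κ x hD t (y + 1))) := by
    rw [← ENNReal.ofReal_add (h _) (h _), ← ENNReal.ofReal_mul (by positivity)]
  simp only [inflow, arrivalRate, meanKernel, if_pos ht, hadd, if_true, Bool.true_eq_false,
    if_false, zero_add]
  split_ifs
  · rw [← ENNReal.ofReal_mul hΛ, ENNReal.ofReal_add
      (mul_nonneg (by positivity) (add_nonneg (h _) (h _))) (mul_nonneg (by positivity) (h 0)),
      add_assoc, ← ENNReal.ofReal_add (mul_nonneg hΛ (h 0)) (mul_nonneg hΛ (h 0))]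
    congr 2
    ring
  · simp

/-- Duhamel's formula as a fixed point equation. The integral over all times reduces to [0, t]:
`decay` vanishes after t, the kernel before 0. -/
lemma meanKernel_eq_add_generationStep (hκ : 0 ≤ κ) (hΛ : 0 ≤ Λ) (t : ℝ) (y : ℤ) :
    meanKernel κ x hD t y = generation κ Λ μ x 0 t y +
      generationStep κ Λ μ (meanKernel κ x hD) t y := by
  have hstep : generationStep κ Λ μ (meanKernel κ x hD) t y = ∫⁻ r in Set.Icc 0 t,
      ENNReal.ofReal (Real.exp (-(totalRate κ Λ μ y * (t - r))) *
        arrivalRate κ Λ (heatKernel κ x hD r) y) := by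
    unfold generationStep
    rw [← lintegral_indicator measurableSet_Icc]
    refine lintegral_congr fun r => ?_
    by_cases hr : r ∈ Set.Icc 0 t
    · rw [Set.indicator_of_mem hr, inflow_meanKernel hD hκ hΛ hr.1, decay, if_pos hr.2,
        ENNReal.ofReal_mul (Real.exp_nonneg _)]
    · rw [Set.indicator_of_notMem hr]
      by_cases h0 : 0 ≤ r
      · rw [decay, if_neg fun h => hr ⟨h0, h⟩, zero_mul]
      · have : meanKernel κ x hD r = fun _ => 0 := funext fun z => if_neg h0
        rw [this, inflow_zero, inflow_zero, add_zero, mul_zero]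
  rw [generation_zero, hstep, meanKernel]
  by_cases ht : 0 ≤ t
  · have hnn : ∀ r ∈ Set.Icc 0 t, 0 ≤ Real.exp (-(totalRate κ Λ μ y * (t - r))) *
        arrivalRate κ Λ (heatKernel κ x hD r) y := fun r hr => by
      have h := heatKernel_nonneg (x := x) hD hκ hr.1
      refine mul_nonneg (Real.exp_nonneg _) (add_nonneg
        (mul_nonneg (by positivity) (add_nonneg (h _) (h _))) ?_)
      split_ifs
      · exact mul_nonneg (by positivity) (h 0)
      · exact le_rfl
    have hc : Continuous fun r => Real.exp (-(totalRate κ Λ μ y * (t - r))) *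
        arrivalRate κ Λ (heatKernel κ x hD r) y :=
      (by fun_prop : Continuous fun r => Real.exp (-(totalRate κ Λ μ y * (t - r)))).mul
        (continuous_arrivalRate hD y)
    rw [if_pos ht, heatKernel_eq_integral, ← ofReal_integral_eq_lintegral_ofReal
      (hc.continuousOn.integrableOn_compact isCompact_Icc)
      ((ae_restrict_iff' measurableSet_Icc).2 (Eventually.of_forall hnn)),
      integral_Icc_eq_integral_Ioc, ← intervalIntegral.integral_of_le ht, ENNReal.ofReal_add]
    · congr 1
      simp only [decay, ht, if_true, sub_zero, eq_comm (a := y)]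
      split_ifs <;> simp
    · split_ifs <;> positivity
    · rw [intervalIntegral.integral_of_le ht, ← integral_Icc_eq_integral_Ioc]
      exact setIntegral_nonneg measurableSet_Icc hnn
  · rw [if_neg ht, decay, if_neg ht, Set.Icc_eq_empty ht]
    simp

lemma meanKernel_eq_sum_add (hκ : 0 < κ) (hΛ : 0 ≤ Λ) (hμ : ∀ z, 0 ≤ μ z) (N : ℕ) (t : ℝ) (y : ℤ) :
    (∀ z, Measurable fun r => (generationStep κ Λ μ)^[N] (meanKernel κ x hD) r z) ∧
    meanKernel κ x hD t y = ∑ n ∈ Finset.range N, generation κ Λ μ x n t y +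
      (generationStep κ Λ μ)^[N] (meanKernel κ x hD) t y := by
  induction N generalizing t y with
  | zero => exact ⟨measurable_meanKernel hD, by simp⟩
  | succ N ih =>
    have hm := (ih t y).1
    have hgm : ∀ z, Measurable fun r => ∑ n ∈ Finset.range N, generation κ Λ μ x n r z := fun z =>
      Finset.measurable_sum _ fun n _ => measurable_generation n z
    have hsum : ∀ N : ℕ, generationStep κ Λ μ
        (fun r z => ∑ n ∈ Finset.range N, generation κ Λ μ x n r z) t y =
          ∑ n ∈ Finset.range N, generation κ Λ μ x (n + 1) t y := by
      intro N
      induction N with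
      | zero => simp [generationStep, inflow_zero]
      | succ N ihN =>
        simp only [Finset.sum_range_succ]
        rw [generationStep_add fun z =>
            Finset.measurable_sum _ fun n _ => measurable_generation n z,
          ihN, generation_succ hκ hΛ hμ]
    simp only [Function.iterate_succ_apply']
    refine ⟨measurable_generationStep hm, ?_⟩
    have hfun : meanKernel κ x hD = fun r z => ∑ n ∈ Finset.range N, generation κ Λ μ x n r z +
        (generationStep κ Λ μ)^[N] (meanKernel κ x hD) r z :=
      funext fun r => funext fun z => (ih r z).2
    rw [meanKernel_eq_add_generationStep hD hκ.le hΛ, Finset.sum_range_succ', ← hsum, add_comm _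
      (generation κ Λ μ x 0 t y), add_assoc, ← generationStep_add hgm, ← hfun]

lemma totalInflow_le (hκ : 0 ≤ κ) (hΛ : 0 ≤ Λ) {f : ℤ → ℝ≥0∞} {m : ℝ≥0∞}
    (hf : ∀ z, f z ≤ m) (y : ℤ) :
    inflow κ Λ false f y + inflow κ Λ true f y ≤ ENNReal.ofReal (κ + 2 * Λ) * m := by
  have h1 : ENNReal.ofReal (κ + 2 * Λ) * m =
      (ENNReal.ofReal (κ / 2) * (m + m) + ENNReal.ofReal Λ * m) + (0 + ENNReal.ofReal Λ * m) := by
    rw [show κ + 2 * Λ = κ / 2 + κ / 2 + (Λ + Λ) by ring, ENNReal.ofReal_add (by positivity)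
      (by positivity), ENNReal.ofReal_add (by positivity) (by positivity),
      ENNReal.ofReal_add hΛ hΛ]
    ring
  have h2 : (if y = 0 then ENNReal.ofReal Λ * f 0 else 0) ≤ ENNReal.ofReal Λ * m := by
    split_ifs
    · gcongr
      exact hf 0
    · exact zero_le
  rw [h1]
  unfold inflow
  simp only [if_true, Bool.true_eq_false, if_false]
  gcongr
  · exact hf _
  · exact hf _

/-- Each step costs a factor κ + 2Λ and one integration over [0, t], hence the factorial. The bound
makes the remainder of the generation expansion vanish. -/
lemma iterate_generationStep_le (hκ : 0 ≤ κ) (hΛ : 0 ≤ Λ) (hR : ∀ z, 0 ≤ totalRate κ Λ μ z)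
    {f : ℝ → ℤ → ℝ≥0∞} {M T : ℝ} (hM : 0 ≤ M) (hT : 0 ≤ T)
    (hneg : ∀ t < 0, ∀ y, f t y = 0) (hf : ∀ t ∈ Set.Icc 0 T, ∀ y, f t y ≤ ENNReal.ofReal M)
    (N : ℕ) : (∀ t < 0, ∀ y, (generationStep κ Λ μ)^[N] f t y = 0) ∧
      ∀ t ∈ Set.Icc 0 T, ∀ y, (generationStep κ Λ μ)^[N] f t y ≤
        ENNReal.ofReal (M * ((κ + 2 * Λ) * t) ^ N / N.factorial) := by
  induction N with
  | zero => exact ⟨hneg, fun t ht y => by simpa using hf t ht y⟩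
  | succ N ih =>
    obtain ⟨ih1, ih2⟩ := ih
    set g := (generationStep κ Λ μ)^[N] f with hg
    simp only [Function.iterate_succ_apply', ← hg]
    have hB : 0 ≤ κ + 2 * Λ := by positivity
    have hle : ∀ t ≤ T, ∀ y r, decay (totalRate κ Λ μ y) t r *
        (inflow κ Λ false (g r) y + inflow κ Λ true (g r) y) ≤ (Set.Icc 0 t).indicator (fun r =>
          ENNReal.ofReal ((κ + 2 * Λ) * (M * ((κ + 2 * Λ) * r) ^ N / N.factorial))) r := by
      intro t ht y r
      by_cases hr : r ∈ Set.Icc 0 t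
      · rw [Set.indicator_of_mem hr, ENNReal.ofReal_mul hB, decay, if_pos hr.2]
        refine (mul_le_of_le_one_left zero_le ?_).trans
          (totalInflow_le hκ hΛ (ih2 r ⟨hr.1, hr.2.trans ht⟩) y)
        rw [← ENNReal.ofReal_one]
        refine ENNReal.ofReal_le_ofReal (Real.exp_le_one_iff.2 ?_)
        have := mul_nonneg (hR y) (sub_nonneg.2 hr.2)
        linarith
      · rw [Set.indicator_of_notMem hr]
        by_cases h0 : 0 ≤ r
        · rw [decay, if_neg fun h => hr ⟨h0, h⟩, zero_mul]
        · have : g r = fun _ => 0 := funext fun z => ih1 r (not_le.1 h0) z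
          rw [this, inflow_zero, inflow_zero, add_zero, mul_zero]
    have hint : ∀ t ≤ T, ∀ y, generationStep κ Λ μ g t y ≤ ∫⁻ r in Set.Icc 0 t,
        ENNReal.ofReal ((κ + 2 * Λ) * (M * ((κ + 2 * Λ) * r) ^ N / N.factorial)) := by
      intro t ht y
      rw [← lintegral_indicator measurableSet_Icc]
      exact lintegral_mono (hle t ht y)
    refine ⟨fun t ht y => ?_, fun t ht y => (hint t ht.2 y).trans (le_of_eq ?_)⟩
    · have h := hint t (ht.le.trans hT) y
      rw [Set.Icc_eq_empty (not_le.2 ht)] at h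
      simpa using h
    · have hc : Continuous fun r : ℝ =>
          (κ + 2 * Λ) * (M * ((κ + 2 * Λ) * r) ^ N / N.factorial) := by fun_prop
      rw [← ofReal_integral_eq_lintegral_ofReal
        (hc.continuousOn.integrableOn_compact isCompact_Icc)
        ((ae_restrict_iff' measurableSet_Icc).2 (Eventually.of_forall fun r hr => by
          have := hr.1
          positivity)), integral_Icc_eq_integral_Ioc, ← intervalIntegral.integral_of_le ht.1]
      congr 1
      have hpow : ∀ r : ℝ, (κ + 2 * Λ) * (M * ((κ + 2 * Λ) * r) ^ N / N.factorial) =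
          (M * (κ + 2 * Λ) ^ (N + 1) / N.factorial) * r ^ N := fun r => by
        rw [mul_pow, pow_succ]
        ring
      simp only [hpow]
      rw [intervalIntegral.integral_const_mul, integral_pow, Nat.factorial_succ, mul_pow]
      push_cast
      field_simp
      ring

theorem meanNumber_eq_heatKernel (hκ : 0 < κ) (hΛ : 0 ≤ Λ) (hμ : ∀ z, 0 ≤ μ z) {t : ℝ} (ht : 0 ≤ t)
    (y : ℤ) : meanNumber κ Λ μ t x y = ENNReal.ofReal (heatKernel κ x hD t y) := by
  -- The ℓ² norm, bounded on compact time intervals, bounds all coordinates at once.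
  obtain ⟨M, hM⟩ : ∃ M : ℝ, ∀ s ∈ Set.Icc 0 t, ∀ z, heatKernel κ x hD s z ≤ M := by
    have hc : Continuous fun s : ℝ => exp (s • schrodinger κ (potential Λ μ) hD) (unit x) :=
      continuous_iff_continuousAt.2 fun s =>
        (ContinuousLinearMap.hasDerivAt_exp_smul_apply _ (unit x) s).continuousAt
    obtain ⟨M, hM⟩ := isCompact_Icc.exists_bound_of_continuousOn (s := Set.Icc 0 t) hc.continuousOn
    exact ⟨M, fun s hs z => (le_abs_self _).trans ((abs_apply_le _ z).trans (hM s hs))⟩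
  have hM0 : 0 ≤ M := (heatKernel_nonneg hD hκ.le le_rfl 0).trans (hM 0 ⟨le_rfl, ht⟩ 0)
  have hrem : Tendsto (fun N => (generationStep κ Λ μ)^[N] (meanKernel κ x hD) t y) atTop
      (𝓝 0) := by
    have hlim : Tendsto (fun N : ℕ => ENNReal.ofReal (M * ((κ + 2 * Λ) * t) ^ N / N.factorial))
        atTop (𝓝 0) := by
      have h := ((FloorSemiring.tendsto_pow_div_factorial_atTop ((κ + 2 * Λ) * t)).const_mul M)
      rw [mul_zero] at h
      simpa [mul_div_assoc] using ENNReal.tendsto_ofReal h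
    refine tendsto_of_tendsto_of_tendsto_of_le_of_le tendsto_const_nhds hlim (fun _ => zero_le)
      fun N => (iterate_generationStep_le hκ.le hΛ (fun z => (totalRate_pos hκ hΛ hμ z).le) hM0 ht
        (fun s hs z => if_neg (not_le.2 hs)) (fun s hs z => ?_) N).2 t ⟨ht, le_rfl⟩ y
    exact (le_of_eq (if_pos hs.1)).trans (ENNReal.ofReal_le_ofReal (hM s hs z))
  have hsum : Tendsto (fun N => ∑ n ∈ Finset.range N, generation κ Λ μ x n t y) atTop
      (𝓝 (∑' n, generation κ Λ μ x n t y)) := ENNReal.tendsto_nat_tsum _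
  have h := hsum.add hrem
  simp only [← (meanKernel_eq_sum_add hD hκ hΛ hμ _ t y).2, add_zero] at h
  rw [meanNumber_eq_tsum hκ hΛ hμ, ← tsum_generation, tendsto_nhds_unique h tendsto_const_nhds]
  exact if_pos ht

end

/-! ### Criteria for supercriticality. -/

section

variable {κ Λ c : ℝ} {μ : KillSite → ℝ}

lemma abs_potential_le (hΛ : 0 ≤ Λ) (hμ : ∀ z, μ z ∈ Set.Icc 0 c) (hc : 0 ≤ c) (z : ℤ) :
    |potential Λ μ z| ≤ Λ + c := by
  unfold potential
  split_ifs with h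
  · rw [abs_of_nonneg hΛ]
    linarith
  · rw [abs_neg, abs_of_nonneg (hμ ⟨z, h⟩).1]
    linarith [(hμ ⟨z, h⟩).2]

lemma potential_zero_nonpos (hμ : ∀ z, 0 ≤ μ z) (z : ℤ) : potential 0 μ z ≤ 0 := by
  unfold potential
  split_ifs with h
  · exact le_rfl
  · exact neg_nonpos.2 (hμ _)

/-- A solution of the island equation makes every environment without killing on the island
supercritical. -/
theorem supercritical_of_island (hκ : 0 < κ) (hΛ : 0 ≤ Λ) (hc : 0 ≤ c)
    (hμ : ∀ z, μ z ∈ Set.Icc 0 c) {l : ℕ} {r : ℝ} (hr : IsPositiveSolution κ Λ c l r)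
    (hl : ∀ z : KillSite, (z : ℤ).natAbs ≤ l → μ z = 0) : Supercritical κ Λ μ := by
  have hμ0 : ∀ z, 0 ≤ μ z := fun z => (hμ z).1
  have hr0 : 0 < r := hr.1
  have heq := (isPositiveSolution_iff hκ hc hr0).1 hr
  -- The equation reads Λ = r + κ(1 - F_l), and F_l < 1.
  have hΛ0 : 0 < Λ := by
    have h1 := (islandPassage_le (innerWeight_pos hκ hr0).le (innerWeight_lt hκ hr0)
      (weightRatio_nonneg hκ hc hr0) (weightRatio_le_one hκ hc hr0) l).trans_lt
      (firstPassage_lt_one (innerWeight_pos hκ hr0).le (innerWeight_lt hκ hr0))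
    nlinarith [mul_lt_mul_of_pos_left h1 hκ]
  have hV := abs_potential_le (Λ := 0) le_rfl hμ hc
  have hW := abs_potential_le hΛ hμ hc
  have hV0 := potential_zero_nonpos hμ0
  have hgreen : 1 ≤ Λ * green hV κ r 0 := by
    refine one_le_mul_green hV hκ hc hr0 hV0 (fun z => ?_) (fun z hz => ?_) heq
    · unfold potential
      split_ifs with h
      · linarith
      · exact neg_le_neg (hμ ⟨z, h⟩).2
    · unfold potential
      split_ifs with h
      · rfl
      · rw [hl ⟨z, h⟩ hz, neg_zero]
  -- The solution `r` of the island equation need not be the growth rate, which is `q`.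
  obtain ⟨q, hq0, hq⟩ := exists_green_eq hV hκ.le hV0 hΛ0 hr0 hgreen
  have hpos : ∀ z, 0 < green hV κ q z := by
    refine green_pos hV hκ hV0 hq0 ?_
    by_contra! h
    nlinarith
  have hnorm : 0 < ‖green hV κ q‖ :=
    ((hpos 0).trans_le (le_abs_self _)).trans_le (abs_apply_le _ 0)
  refine ⟨q, hq0, fun x y => green hV κ q x * green hV κ q y / ‖green hV κ q‖ ^ 2, fun x y => ?_⟩
  have hC : 0 < green hV κ q x * green hV κ q y / ‖green hV κ q‖ ^ 2 :=
    div_pos (mul_pos (hpos x) (hpos y)) (by positivity)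
  refine ⟨hC, ?_⟩
  have hlim := tendsto_exp_smul_schrodinger hV hκ.le hV0 hW (Λ := Λ) (fun z => by
    unfold potential
    split_ifs <;> simp) hq0 hq x y
  have hlim2 := (hlim.div_const _).congr' (f₂ := fun t => heatKernel κ x hW t y /
    (green hV κ q x * green hV κ q y / ‖green hV κ q‖ ^ 2 * Real.exp (q * t)))
    (Eventually.of_forall fun t => by
      rw [div_div, mul_comm (Real.exp _)]
      rfl)
  rw [div_self hC.ne'] at hlim2
  have hlim3 := ENNReal.tendsto_ofReal hlim2
  rw [ENNReal.ofReal_one] at hlim3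
  refine hlim3.congr' ?_
  filter_upwards [eventually_ge_atTop 0] with t ht
  rw [meanNumber_eq_heatKernel hW hκ hΛ hμ0 ht,
    ENNReal.ofReal_div_of_pos (mul_pos hC (Real.exp_pos _))]

/-- Without branching no environment is supercritical. -/
theorem not_supercritical_of_eq_zero (hκ : 0 < κ) (hc : 0 ≤ c) (hμ : ∀ z, μ z ∈ Set.Icc 0 c) :
    ¬ Supercritical κ 0 μ := by
  rintro ⟨r, hr, C, hC⟩
  have hμ0 : ∀ z, 0 ≤ μ z := fun z => (hμ z).1
  have hV := abs_potential_le (Λ := 0) le_rfl hμ hc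
  obtain ⟨hC0, hlim⟩ := hC 0 0
  -- The semigroup is a contraction when Λ = 0, so the quotient by a growing exponential tends to 0,
  -- not to 1.
  have hle : ∀ t : ℝ, 0 ≤ t → meanNumber κ 0 μ t 0 0 ≤ 1 := by
    intro t ht
    rw [meanNumber_eq_heatKernel hV hκ le_rfl hμ0 ht, ← ENNReal.ofReal_one]
    refine ENNReal.ofReal_le_ofReal ((le_abs_self _).trans ((abs_apply_le _ 0).trans ?_))
    rw [← norm_unit 0]
    exact ContinuousLinearMap.norm_exp_smul_apply_le
      (inner_schrodinger_self_nonpos hV hκ.le (potential_zero_nonpos hμ0)) ht _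
  have hexp : Tendsto (fun t : ℝ => ENNReal.ofReal (C 0 0 * Real.exp (r * t))) atTop (𝓝 ∞) :=
    ENNReal.tendsto_ofReal_nhds_top.2 ((Real.tendsto_exp_atTop.comp
      (tendsto_id.const_mul_atTop hr)).const_mul_atTop hC0)
  have hinv := tendsto_inv_iff.2 hexp
  rw [ENNReal.inv_top] at hinv
  have hzero : Tendsto (fun t : ℝ => meanNumber κ 0 μ t 0 0 /
      ENNReal.ofReal (C 0 0 * Real.exp (r * t))) atTop (𝓝 0) := by
    refine tendsto_of_tendsto_of_tendsto_of_le_of_le' tendsto_const_nhds hinv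
      (Eventually.of_forall fun _ => zero_le) ?_
    filter_upwards [eventually_ge_atTop 0] with t ht
    rw [← one_div]
    exact ENNReal.div_le_div_right (hle t ht) _
  exact zero_ne_one (tendsto_nhds_unique hzero hlim)

end

/-- The sites of the island of size `l`. -/
def islandSites (l : ℕ) : Finset KillSite :=
  ((Finset.Icc (-(l : ℤ)) l).erase 0).subtype fun z => z ≠ 0

lemma mem_islandSites {l : ℕ} {z : KillSite} : z ∈ islandSites l ↔ (z : ℤ).natAbs ≤ l := by
  have := z.2
  simp only [islandSites, Finset.mem_subtype, Finset.mem_erase, Finset.mem_Icc]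
  omega

lemma card_islandSites (l : ℕ) : (islandSites l).card = 2 * l := by
  rw [islandSites, Finset.card_subtype, Finset.filter_true_of_mem
    (fun z hz => (Finset.mem_erase.1 hz).1), Finset.card_erase_of_mem (by simp), Int.card_Icc]
  omega

end BRW
end

theorem theorem4 {Ω : Type*} [MeasurableSpace Ω] (P : Measure Ω) [IsProbabilityMeasure P]
    (κ Λ c : ℝ) (hκ : 0 < κ) (hΛ : 0 ≤ Λ) (hc : 0 ≤ c)
    (μ : BRW.KillSite → Ω → ℝ)
    (hμ_meas : ∀ z, Measurable (μ z))
    (hμ_indep : iIndepFun μ P)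
    (hμ_ident : ∀ z z', IdentDistrib (μ z) (μ z') P P)
    (hμ_range : ∀ z ω, μ z ω ∈ Set.Icc 0 c) :
    (∀ l : ℕ, IsLeast (BRW.admissibleSizes κ Λ c) l →
      ∀ z, P {ω | μ z ω = 0} ^ (2 * l) ≤ BRW.growthProb P κ Λ μ) ∧
    (BRW.admissibleSizes κ Λ c = ∅ → BRW.growthProb P κ Λ μ = 0) := by
  constructor
  · intro l hl z
    obtain ⟨-, r, hr⟩ := hl.1
    have hprob : P (⋂ z' ∈ BRW.islandSites l, μ z' ⁻¹' {0}) = P {ω | μ z ω = 0} ^ (2 * l) := by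
      rw [hμ_indep.measure_inter_preimage_eq_mul (BRW.islandSites l)
        (fun _ _ => measurableSet_singleton 0), ← BRW.card_islandSites l]
      refine Finset.prod_eq_pow_card fun z' _ => ?_
      exact (hμ_ident z' z).measure_preimage_eq (measurableSet_singleton 0)
    rw [← hprob]
    -- Monotonicity holds for arbitrary sets, so measurability of the supercritical event is not
    -- needed.
    refine measure_mono fun ω hω => ?_
    refine BRW.supercritical_of_island hκ hΛ hc (fun z' => hμ_range z' ω) hr fun z' hz' => ?_
    exact Set.mem_iInter₂.1 hω z' (BRW.mem_islandSites.2 hz')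
  · intro hempty
    obtain rfl : Λ = 0 := by
      by_contra h
      exact (BRW.admissibleSizes_nonempty hκ (hΛ.lt_of_ne' h) hc).ne_empty hempty
    have : {ω | BRW.Supercritical κ 0 fun z => μ z ω} = ∅ :=
      Set.eq_empty_of_forall_notMem fun ω =>
        BRW.not_supercritical_of_eq_zero hκ hc fun z => hμ_range z ω
    rw [BRW.growthProb, this, measure_empty]
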